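/- **Theorem (uniform distortion fields in constant curvature).** Let $(M,g)$ be a nonempty smooth Riemannian 3-manifold with Levi-Civita connection $\nabla$ and constant sectional curvature $R_0$, i.e. $R(X,Y)Z=R_0(\langle Y,Z\rangle X-\langle X,Z\rangle Y)$, and let $\mathbf n$ be a director field (a smooth unit vector field) on $M$. In a local smooth orthonormal frame $(\mathbf n,\mathbf n_2,\mathbf n_3)$ (taken as positively oriented) the deformation modes $s,t,b_\perp,b_\times,\Delta_1,\Delta_2$ of $\mathbf n$ are defined by $$\nabla_{\mathbf n}\mathbf n=-\mathbf b=-(b_\perp\mathbf n_2+b_\times\mathbf n_3),\quad \nabla_{\mathbf n_2}\mathbf n=\left(\tfrac s2+\Delta_1\right)\mathbf n_2+\left(\tfrac t2+\Delta_2\right)\mathbf n_3,\quad \nabla_{\mathbf n_3}\mathbf n=\left(-\tfrac t2+\Delta_2\right)\mathbf n_2+\left(\tfrac s2-\Delta_1\right)\mathbf n_3 .$$ Put $b=\sqrt{b_\perp^2+b_\times^2}$, $\Delta=\sqrt{\Delta_1^2+\Delta_2^2}$, $\langle D\mathbf b,\mathbf b\rangle=(b_\perp^2-b_\times^2)\Delta_1+2b_\perp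 b_\times\Delta_2$ and $\langle JD\mathbf b,\mathbf b\rangle=(b_\times^2-b_\perp^2)\Delta_2+2b_\perp b_\times\Delta_1$. If $b\neq0$ and $\Delta\ne0$, let $\phi\in[0,2\pi)$ be the counterclockwise angle from a principal direction of the biaxial splay (a unit eigenvector for the eigenvalue $\Delta$ of the matrix $D=\begin{pmatrix}\Delta_1&\Delta_2\\ \Delta_2&-\Delta_1\end{pmatrix}$) to $\mathbf b$. Suppose that all modes are constant: around every point there is such a frame in which the six modes equal given constants $s,t,b_\perp,b_\times,\Delta_1,\Delta_2$. Then: (a) If $R_0>0$, then $s=b=\Delta=0$ and $t=\pm2\sqrt{R_0}$. (b) If $R_0=0$: when $\Delta=0$, then $b=s=t=0$; when $\Delta\neq0$, then $s=0$, $t=\pm2\Delta$ and, if $b\ne0$, the bend bisects the principal directions of the biaxial splay: $\phi=\frac{(2k+1)\pi}4$ with $k\in\{0,2\}$ if $t=2\Delta$ and $k\in\{1,3\}$ if $t=-2\Delta$. (c) If $R_0<0$: when $\Delta=0$, then $t=0$ and $s^2+4b^2=-4R_0$; when $\Delta\ne0$, then $t=\pm2\Delta$, $s=-\frac1{2\Delta^2}\langle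 D\mathbf b,\mathbf b\rangle$, the modes satisfy $1+\frac{b^2}{4\Delta^2}\ge\sqrt{-\frac{R_0}{\Delta^2}}$, and more precisely $$2R_0=-b^2-\frac{s^2}2+\frac{t}{2\Delta^2}\langle JD\mathbf b,\mathbf b\rangle.\qquad(*)$$ Conversely, bend and biaxial splay are free parameters in these families: all constants $R_0,s,t,b_\perp,b_\times,\Delta_1,\Delta_2$ that satisfy the conditions of one of the cases above (in the last case of (c): $t=\pm2\Delta$, the formula for $s$, and $(*)$) are the curvature and the deformation modes of a director field with constant modes for some Riemannian metric of constant sectional curvature $R_0$ on a 3-manifold diffeomorphic to $\mathbb R^3$. -/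

import Mathlib

open Set Filter Topology Bundle Manifold
open scoped ContDiff

noncomputable section

/-- The model space of a 3-manifold. -/
abbrev E3 : Type := EuclideanSpace ℝ (Fin 3)

section Geometry

variable {M : Type*} [TopologicalSpace M] [ChartedSpace E3 M] [IsManifold (𝓡 3) ∞ M]

/-- Smooth Riemannian metrics on the 3-manifold `M`. -/
abbrev Metric3 (M : Type*) [TopologicalSpace M] [ChartedSpace E3 M] [IsManifold (𝓡 3) ∞ M] :=
  ContMDiffRiemannianMetric (𝓡 3) ∞ E3 (fun x : M => TangentSpace (𝓡 3) x)

/-- Affine connections on `M`. With Mathlib's argument order, `cov Y x (X x)` is `(∇_X Y)(x)`. -/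
abbrev Connection3 (M : Type*) [TopologicalSpace M] [ChartedSpace E3 M] [IsManifold (𝓡 3) ∞ M] :=
  CovariantDerivative (𝓡 3) E3 (fun x : M => TangentSpace (𝓡 3) x)

/-- A vector field, viewed as a map from `M` to its tangent bundle. -/
abbrev asSection (X : Π x : M, TangentSpace (𝓡 3) x) : M → TangentBundle (𝓡 3) M :=
  fun x => ⟨x, X x⟩

/-- `cov` is the Levi-Civita connection of `g`: it is torsion free,
`∇_X Y - ∇_Y X = [X, Y]`, and compatible with the metric,
`X ⟨Y, Z⟩ = ⟨∇_X Y, Z⟩ + ⟨Y, ∇_X Z⟩`. -/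
structure IsLeviCivita (g : Metric3 M) (cov : Connection3 M) : Prop where
  torsion_free : ∀ (X Y : Π x : M, TangentSpace (𝓡 3) x) (x : M),
    MDifferentiableAt (𝓡 3) ((𝓡 3).prod 𝓘(ℝ, E3)) (asSection X) x →
    MDifferentiableAt (𝓡 3) ((𝓡 3).prod 𝓘(ℝ, E3)) (asSection Y) x →
      cov Y x (X x) - cov X x (Y x) = VectorField.mlieBracket (𝓡 3) X Y x
  metric : ∀ (Y Z : Π x : M, TangentSpace (𝓡 3) x) (x : M) (v : TangentSpace (𝓡 3) x),
    MDifferentiableAt (𝓡 3) ((𝓡 3).prod 𝓘(ℝ, E3)) (asSection Y) x →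
    MDifferentiableAt (𝓡 3) ((𝓡 3).prod 𝓘(ℝ, E3)) (asSection Z) x →
      mvfderiv (𝓡 3) (fun y => g.inner y (Y y) (Z y)) x v =
        g.inner x (cov Y x v) (Z x) + g.inner x (Y x) (cov Z x v)

/-- The curvature operator `R(X,Y)Z = ∇_X ∇_Y Z - ∇_Y ∇_X Z - ∇_[X,Y] Z` at `x`. -/
def curvatureOp (cov : Connection3 M) (X Y Z : Π x : M, TangentSpace (𝓡 3) x) (x : M) :
    TangentSpace (𝓡 3) x :=
  cov (fun y => cov Z y (Y y)) x (X x) - cov (fun y => cov Z y (X y)) x (Y x)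
    - cov Z x (VectorField.mlieBracket (𝓡 3) X Y x)

/-- `cov` has constant sectional curvature `R₀` with respect to `g`: the curvature tensor is
`R(X,Y)Z = R₀ (⟨Y,Z⟩ X - ⟨X,Z⟩ Y)`. -/
def HasConstantCurvature (g : Metric3 M) (cov : Connection3 M) (R₀ : ℝ) : Prop :=
  ∀ (X Y Z : Π x : M, TangentSpace (𝓡 3) x) (x : M),
    ContMDiffAt (𝓡 3) ((𝓡 3).prod 𝓘(ℝ, E3)) ∞ (asSection X) x →
    ContMDiffAt (𝓡 3) ((𝓡 3).prod 𝓘(ℝ, E3)) ∞ (asSection Y) x →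
    ContMDiffAt (𝓡 3) ((𝓡 3).prod 𝓘(ℝ, E3)) ∞ (asSection Z) x →
      curvatureOp cov X Y Z x = R₀ • (g.inner x (Y x) (Z x) • X x - g.inner x (X x) (Z x) • Y x)

/-- A director field: a smooth unit vector field on `M`. -/
structure IsDirectorField (g : Metric3 M) (n : Π x : M, TangentSpace (𝓡 3) x) : Prop where
  smooth : ContMDiff (𝓡 3) ((𝓡 3).prod 𝓘(ℝ, E3)) ∞ (asSection n)
  unit : ∀ x, g.inner x (n x) (n x) = 1

/-- On the open set `U`, the fields `n, n₂, n₃` form a smooth orthonormal frame. The local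
orientation used for the pseudoscalar modes is the one for which `(n, n₂, n₃)` is positive. -/
structure IsAdaptedFrameOn (g : Metric3 M) (n n₂ n₃ : Π x : M, TangentSpace (𝓡 3) x)
    (U : Set M) : Prop where
  isOpen : IsOpen U
  smooth₂ : ContMDiffOn (𝓡 3) ((𝓡 3).prod 𝓘(ℝ, E3)) ∞ (asSection n₂) U
  smooth₃ : ContMDiffOn (𝓡 3) ((𝓡 3).prod 𝓘(ℝ, E3)) ∞ (asSection n₃) U
  unit₂ : ∀ x ∈ U, g.inner x (n₂ x) (n₂ x) = 1
  unit₃ : ∀ x ∈ U, g.inner x (n₃ x) (n₃ x) = 1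
  orth₁₂ : ∀ x ∈ U, g.inner x (n x) (n₂ x) = 0
  orth₁₃ : ∀ x ∈ U, g.inner x (n x) (n₃ x) = 0
  orth₂₃ : ∀ x ∈ U, g.inner x (n₂ x) (n₃ x) = 0

/-- The component `⟨∇_u n, v⟩` of the gradient of `n`, for vector fields `u` and `v`. -/
def gradComp (g : Metric3 M) (cov : Connection3 M) (n u v : Π x : M, TangentSpace (𝓡 3) x)
    (x : M) : ℝ :=
  g.inner x (cov n x (u x)) (v x)

/-- The bend vector `𝐛 = -∇_n n`. -/
def bendVector (cov : Connection3 M) (n : Π x : M, TangentSpace (𝓡 3) x) (x : M) :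
    TangentSpace (𝓡 3) x :=
  -(cov n x (n x))

/-- The splay `s`, the divergence of `n` (note that `⟨∇_n n, n⟩ = 0`). -/
def splay (g : Metric3 M) (cov : Connection3 M) (n n₂ n₃ : Π x : M, TangentSpace (𝓡 3) x)
    (x : M) : ℝ :=
  gradComp g cov n n₂ n₂ x + gradComp g cov n n₃ n₃ x

/-- The twist `t = n · curl n`. -/
def twist (g : Metric3 M) (cov : Connection3 M) (n n₂ n₃ : Π x : M, TangentSpace (𝓡 3) x)
    (x : M) : ℝ :=
  gradComp g cov n n₂ n₃ x - gradComp g cov n n₃ n₂ x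

/-- The diagonal coefficient `Δ₁` of the biaxial splay, the traceless symmetric part
`!![Δ₁, Δ₂; Δ₂, -Δ₁]` of the gradient of `n` on the plane spanned by `n₂, n₃`. -/
def biaxialSplay₁ (g : Metric3 M) (cov : Connection3 M)
    (n n₂ n₃ : Π x : M, TangentSpace (𝓡 3) x) (x : M) : ℝ :=
  (gradComp g cov n n₂ n₂ x - gradComp g cov n n₃ n₃ x) / 2

/-- The off-diagonal coefficient `Δ₂` of the biaxial splay. -/
def biaxialSplay₂ (g : Metric3 M) (cov : Connection3 M)
    (n n₂ n₃ : Π x : M, TangentSpace (𝓡 3) x) (x : M) : ℝ :=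
  (gradComp g cov n n₂ n₃ x + gradComp g cov n n₃ n₂ x) / 2

/-- The director field `n` has constant deformation modes `s, t, b⊥, b×, Δ₁, Δ₂`: around each
point there is an adapted frame in which the modes take these values. -/
def HasConstantModes (g : Metric3 M) (cov : Connection3 M) (n : Π x : M, TangentSpace (𝓡 3) x)
    (s t bp bx D₁ D₂ : ℝ) : Prop :=
  ∀ p : M, ∃ U : Set M, p ∈ U ∧ ∃ n₂ n₃ : Π x : M, TangentSpace (𝓡 3) x,
    IsAdaptedFrameOn g n n₂ n₃ U ∧ ∀ x ∈ U,
      splay g cov n n₂ n₃ x = s ∧ twist g cov n n₂ n₃ x = t ∧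
      g.inner x (bendVector cov n x) (n₂ x) = bp ∧
      g.inner x (bendVector cov n x) (n₃ x) = bx ∧
      biaxialSplay₁ g cov n n₂ n₃ x = D₁ ∧ biaxialSplay₂ g cov n n₂ n₃ x = D₂

/-- On the Riemannian 3-manifold `(M, g)` with Levi-Civita connection `cov` and constant sectional
curvature `R₀`, the director field `n` has the constant deformation modes
`s, t, b⊥, b×, Δ₁, Δ₂`. -/
structure IsUniformDistortion (g : Metric3 M) (cov : Connection3 M)
    (n : Π x : M, TangentSpace (𝓡 3) x) (R₀ s t bp bx D₁ D₂ : ℝ) : Prop where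
  leviCivita : IsLeviCivita g cov
  curvature : HasConstantCurvature g cov R₀
  director : IsDirectorField g n
  modes : HasConstantModes g cov n s t bp bx D₁ D₂

end Geometry

/-- The bend `b`, the norm of the bend vector `b⊥ n₂ + b× n₃`. -/
def bendNorm (bp bx : ℝ) : ℝ := Real.sqrt (bp ^ 2 + bx ^ 2)

/-- The magnitude `Δ` of the biaxial splay. -/
def splayNorm (D₁ D₂ : ℝ) : ℝ := Real.sqrt (D₁ ^ 2 + D₂ ^ 2)

/-- `⟨D𝐛, 𝐛⟩` for the operator `D = !![Δ₁, Δ₂; Δ₂, -Δ₁]` on the normal plane. -/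
def formDb (bp bx D₁ D₂ : ℝ) : ℝ := (bp ^ 2 - bx ^ 2) * D₁ + 2 * bp * bx * D₂

/-- `⟨JD𝐛, 𝐛⟩`, where `J` is the counterclockwise rotation by `π / 2` of the normal plane. -/
def formJDb (bp bx D₁ D₂ : ℝ) : ℝ := (bx ^ 2 - bp ^ 2) * D₂ + 2 * bp * bx * D₁

/-- `φ ∈ [0, 2π)` is an angle of the nonzero bend vector measured counterclockwise from a principal
direction of the biaxial splay: there is a unit vector `e = (e₁, e₂)` of the normal plane with
`D e = Δ e` and `𝐛 = b (cos φ e + sin φ J e)`. -/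
def IsBendAngle (bp bx D₁ D₂ φ : ℝ) : Prop :=
  bendNorm bp bx ≠ 0 ∧ 0 ≤ φ ∧ φ < 2 * Real.pi ∧
  ∃ e₁ e₂ : ℝ, e₁ ^ 2 + e₂ ^ 2 = 1 ∧
    D₁ * e₁ + D₂ * e₂ = splayNorm D₁ D₂ * e₁ ∧ D₂ * e₁ - D₁ * e₂ = splayNorm D₁ D₂ * e₂ ∧
    bp = bendNorm bp bx * (Real.cos φ * e₁ - Real.sin φ * e₂) ∧
    bx = bendNorm bp bx * (Real.cos φ * e₂ + Real.sin φ * e₁)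

/-- The bend vector bisects the principal directions of the biaxial splay, on the side given by the
sign of the twist `t = ±2Δ`: its angle `φ = (2k+1)π/4` has `k ∈ {0, 2}` if `t = 2Δ` and
`k ∈ {1, 3}` if `t = -2Δ`. (No condition if the bend vanishes.) -/
def BendBisects (t bp bx D₁ D₂ : ℝ) : Prop :=
  ∀ φ : ℝ, IsBendAngle bp bx D₁ D₂ φ → ∃ k : ℕ, φ = (2 * k + 1) * Real.pi / 4 ∧
    ((t = 2 * splayNorm D₁ D₂ ∧ (k = 0 ∨ k = 2)) ∨
      (t = -(2 * splayNorm D₁ D₂) ∧ (k = 1 ∨ k = 3)))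

end

/-! Write ∇ in an adapted frame. Besides the modes it involves only three functions, the
coefficients `a₁, a₂, a₃` of the connection of the normal plane. Since the components of ∇n are
constant, the curvature R(e_i, e_j)n contains no derivatives. Constant curvature therefore gives six
algebraic equations at each point (`CodazziEquations`), linear in the `a`'s.

If Δ = 0, these equations suffice (`CodazziEquations.of_splayNorm_eq_zero`). They give t𝐛 = 0, and
then either b = 0, st = 0 and s² - t² + 4R₀ = 0, or t = 0 and s² + 4b² = -4R₀.

If Δ ≠ 0, they determine the `a`'s in terms of the modes, so the `a`'s are constant too, and the
curvature of the normal plane becomes a further algebraic equation (`GaussEquation`). Eliminating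
the `a`'s and R₀ leaves (t² - 4Δ²)(4Δ² + b²) = 0, hence t = ±2Δ (`CodazziEquations.twist_sq`). The
remaining combinations give s and (*); together they form `BiaxialModes`. The identity ⟨D𝐛,𝐛⟩² +
⟨JD𝐛,𝐛⟩² = Δ²b⁴ then yields 4R₀ ≤ -s². This rules out R₀ > 0 and forces s = 0 when R₀ = 0; there (*)
reads sin 2φ = ±1, the bisection property.

For the converse, a global frame on ℝ³ is declared orthonormal. If its brackets have constant
coefficients, as for a left-invariant frame of a Lie group, then torsion, metric compatibility and
curvature all become algebra in a constant bilinear map Γ (`Parallelization.isUniformDistortion`).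
The groups used are semidirect products of ℝ and ℝ² for Δ ≠ 0 and for R₀ ≤ 0, and the 3-sphere in
stereographic coordinates for R₀ > 0. -/

noncomputable section

/-! ### Connection and curvature in orthonormal frames. -/

section Frames

variable {M : Type*} [TopologicalSpace M] [ChartedSpace E3 M] [IsManifold (𝓡 3) ∞ M]

/-- On the open set `U`, the vector fields `e 0, e 1, e 2` form a smooth orthonormal frame. -/
structure IsOrthonormalFrameOn (g : Metric3 M) (e : Fin 3 → Π x : M, TangentSpace (𝓡 3) x)
    (U : Set M) : Prop where
  isOpen : IsOpen U
  smooth : ∀ i, ContMDiffOn (𝓡 3) ((𝓡 3).prod 𝓘(ℝ, E3)) ∞ (asSection (e i)) U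
  orthonormal : ∀ x ∈ U, ∀ i j, g.inner x (e i x) (e j x) = if i = j then 1 else 0

/-- The connection coefficients `⟨∇_{e i} e j, e k⟩` of a frame. -/
def connCoeff (g : Metric3 M) (cov : Connection3 M) (e : Fin 3 → Π x : M, TangentSpace (𝓡 3) x)
    (i j k : Fin 3) (x : M) : ℝ :=
  g.inner x (cov (e j) x (e i x)) (e k x)

namespace IsOrthonormalFrameOn

variable {g : Metric3 M} {cov : Connection3 M} {e : Fin 3 → Π x : M, TangentSpace (𝓡 3) x}
  {U : Set M} {x : M}

theorem contMDiffAt (h : IsOrthonormalFrameOn g e U) (hx : x ∈ U) (i : Fin 3) :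
    ContMDiffAt (𝓡 3) ((𝓡 3).prod 𝓘(ℝ, E3)) ∞ (asSection (e i)) x :=
  (h.smooth i).contMDiffAt (h.isOpen.mem_nhds hx)

theorem mdifferentiableAt (h : IsOrthonormalFrameOn g e U) (hx : x ∈ U) (i : Fin 3) :
    MDifferentiableAt (𝓡 3) ((𝓡 3).prod 𝓘(ℝ, E3)) (asSection (e i)) x :=
  (h.contMDiffAt hx i).mdifferentiableAt (by simp)

theorem expand (h : IsOrthonormalFrameOn g e U) (hx : x ∈ U) (v : TangentSpace (𝓡 3) x) :
    v = ∑ k, g.inner x v (e k x) • e k x := by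
  have hli : LinearIndependent ℝ (fun i => e i x) := by
    rw [Fintype.linearIndependent_iff]
    intro c hc i
    have := congrArg (fun w => g.inner x w (e i x)) hc
    simpa [map_sum, h.orthonormal x hx] using this
  have hcard : Fintype.card (Fin 3) = Module.finrank ℝ (TangentSpace (𝓡 3) x) := by
    change _ = Module.finrank ℝ E3
    simp
  have : FiniteDimensional ℝ (TangentSpace (𝓡 3) x) := inferInstanceAs (FiniteDimensional ℝ E3)
  have hspan := hli.span_eq_top_of_card_eq_finrank' hcard
  have hv : v ∈ Submodule.span ℝ (Set.range fun i => e i x) := hspan ▸ Submodule.mem_top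
  obtain ⟨c, rfl⟩ := (Submodule.mem_span_range_iff_exists_fun ℝ).1 hv
  simp [map_sum, h.orthonormal x hx]

theorem connCoeff_antisymm (h : IsOrthonormalFrameOn g e U) (hcov : IsLeviCivita g cov)
    (hx : x ∈ U) (i j k : Fin 3) :
    connCoeff g cov e i j k x = -connCoeff g cov e i k j x := by
  have hm := hcov.metric (e j) (e k) x (e i x) (h.mdifferentiableAt hx j) (h.mdifferentiableAt hx k)
  have hc : (fun y => g.inner y (e j y) (e k y)) =ᶠ[𝓝 x] fun _ => if j = k then 1 else 0 := by
    filter_upwards [h.isOpen.mem_nhds hx] with y hy using h.orthonormal y hy j k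
  have h0 : mvfderiv (𝓡 3) (fun y => g.inner y (e j y) (e k y)) x (e i x) = 0 := by
    have : mvfderiv (𝓡 3) (fun y => g.inner y (e j y) (e k y)) x = 0 := by
      unfold mvfderiv
      rw [hc.mfderiv_eq]
      ext v
      rw [mfderiv_const]
      exact (NormedSpace.fromTangentSpace _).map_zero
    simp [this]
  rw [h0, g.symm x (e j x)] at hm
  unfold connCoeff
  linarith

theorem cov_apply (h : IsOrthonormalFrameOn g e U) (hx : x ∈ U) (i j : Fin 3) :
    cov (e j) x (e i x) = ∑ k, connCoeff g cov e i j k x • e k x :=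
  h.expand hx _

theorem mlieBracket_eq (h : IsOrthonormalFrameOn g e U) (hcov : IsLeviCivita g cov)
    (hx : x ∈ U) (i j : Fin 3) :
    VectorField.mlieBracket (𝓡 3) (e i) (e j) x =
      ∑ k, (connCoeff g cov e i j k x - connCoeff g cov e j i k x) • e k x := by
  rw [← hcov.torsion_free _ _ x (h.mdifferentiableAt hx i) (h.mdifferentiableAt hx j),
    h.cov_apply hx, h.cov_apply hx]
  simp [sub_smul, Finset.sum_sub_distrib]

theorem mdifferentiableAt_comb (h : IsOrthonormalFrameOn g e U) (hx : x ∈ U) (c : Fin 3 → ℝ) :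
    MDifferentiableAt (𝓡 3) ((𝓡 3).prod 𝓘(ℝ, E3)) (asSection fun y => ∑ k, c k • e k y) x := by
  have hs : ∀ k, ContMDiffAt (𝓡 3) ((𝓡 3).prod 𝓘(ℝ, E3)) ∞ (asSection (c k • e k)) x := fun k =>
    (h.contMDiffAt hx k).const_smul_section
  have := ((hs 0).add_section (hs 1)).add_section (hs 2)
  have h2 : (asSection fun y => ∑ k, c k • e k y)
      = asSection (c 0 • e 0 + c 1 • e 1 + c 2 • e 2) := by
    funext y; simp [Fin.sum_univ_three]
  rw [h2]
  exact this.mdifferentiableAt (by simp)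

theorem cov_comb (h : IsOrthonormalFrameOn g e U) (hx : x ∈ U) (c : Fin 3 → ℝ) :
    cov (fun y => ∑ k, c k • e k y) x = ∑ k, c k • cov (e k) x := by
  have hs : ∀ k, ContMDiffAt (𝓡 3) ((𝓡 3).prod 𝓘(ℝ, E3)) ∞ (asSection (c k • e k)) x := fun k =>
    (h.contMDiffAt hx k).const_smul_section
  have hc := cov.isCovariantDerivativeOnUniv
  have h2 : (fun y => ∑ k, c k • e k y) = c 0 • e 0 + c 1 • e 1 + c 2 • e 2 := by
    funext y; simp [Fin.sum_univ_three]
  rw [h2, hc.add (((hs 0).add_section (hs 1)).mdifferentiableAt (by simp))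
      ((hs 2).mdifferentiableAt (by simp)),
    hc.add ((hs 0).mdifferentiableAt (by simp)) ((hs 1).mdifferentiableAt (by simp)),
    hc.smul_const _ (h.mdifferentiableAt hx 0), hc.smul_const _ (h.mdifferentiableAt hx 1),
    hc.smul_const _ (h.mdifferentiableAt hx 2), Fin.sum_univ_three]

theorem cov_cov (h : IsOrthonormalFrameOn g e U) (hx : x ∈ U) {i j : Fin 3} {c : Fin 3 → ℝ}
    (hc : ∀ y ∈ U, ∀ k, connCoeff g cov e i j k y = c k) :
    cov (fun y => cov (e j) y (e i y)) x = ∑ k, c k • cov (e k) x := by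
  rw [← h.cov_comb hx]
  have heq : ∀ᶠ y in 𝓝 x, cov (e j) y (e i y) = ∑ k, c k • e k y := by
    filter_upwards [h.isOpen.mem_nhds hx] with y hy
    rw [h.cov_apply hy]
    simp [hc y hy]
  refine cov.isCovariantDerivativeOnUniv.congr_of_eventuallyEq ?_ (h.mdifferentiableAt_comb hx c)
    univ_mem heq
  refine (h.mdifferentiableAt_comb hx c).congr_of_eventuallyEq ?_
  filter_upwards [heq] with y hy
  simp [asSection, hy]

/-- The curvature of a frame for which the covariant derivatives of `e j` have constant
components. -/
theorem curvature_eq (h : IsOrthonormalFrameOn g e U) (hcov : IsLeviCivita g cov) {R₀ : ℝ}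
    (hR : HasConstantCurvature g cov R₀) (hx : x ∈ U) {j : Fin 3} {C : Fin 3 → Fin 3 → ℝ}
    (hC : ∀ y ∈ U, ∀ i k, connCoeff g cov e i j k y = C i k) (i i' l : Fin 3) :
    ∑ k, (C i' k * connCoeff g cov e i k l x - C i k * connCoeff g cov e i' k l x)
      - ∑ m, (connCoeff g cov e i i' m x - connCoeff g cov e i' i m x) * C m l =
    R₀ * ((if i' = j then 1 else 0) * (if i = l then 1 else 0)
      - (if i = j then 1 else 0) * (if i' = l then 1 else 0)) := by
  have hk := hR (e i) (e i') (e j) x (h.contMDiffAt hx i) (h.contMDiffAt hx i')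
    (h.contMDiffAt hx j)
  unfold curvatureOp at hk
  -- Constancy is needed only for the derivatives of the one field `e j`; the other connection
  -- coefficients enter undifferentiated.
  rw [h.cov_cov hx (fun y hy k => hC y hy i' k), h.cov_cov hx (fun y hy k => hC y hy i k),
    h.mlieBracket_eq hcov hx] at hk
  have hl := congrArg (fun w => g.inner x w (e l x)) hk
  have hCx := fun i k => hC x hx i k
  simp only [connCoeff] at hCx
  simp only [map_sub, map_smul, map_sum, sum_apply, sub_apply, smul_apply,
    smul_eq_mul, h.orthonormal x hx, hCx] at hl
  rw [← hl, Finset.sum_sub_distrib]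
  rfl

end IsOrthonormalFrameOn
end Frames
section AdaptedFrame

variable {M : Type*} [TopologicalSpace M] [ChartedSpace E3 M]
  {n n₂ n₃ : Π x : M, TangentSpace (𝓡 3) x}

/-- The triple of vector fields `n, n₂, n₃`. -/
def adaptedFrame (n n₂ n₃ : Π x : M, TangentSpace (𝓡 3) x) : Fin 3 → Π x : M, TangentSpace (𝓡 3) x
  | 0 => n
  | 1 => n₂
  | 2 => n₃

@[simp] theorem adaptedFrame_zero : adaptedFrame n n₂ n₃ 0 = n := rfl

@[simp] theorem adaptedFrame_one : adaptedFrame n n₂ n₃ 1 = n₂ := rfl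

@[simp] theorem adaptedFrame_two : adaptedFrame n n₂ n₃ 2 = n₃ := rfl

end AdaptedFrame

/-! ### The Codazzi and Gauss equations of a director field with constant modes. -/

section Uniform

variable {M : Type*} [TopologicalSpace M] [ChartedSpace E3 M] [IsManifold (𝓡 3) ∞ M]
  {g : Metric3 M} {cov : Connection3 M} {n n₂ n₃ : Π x : M, TangentSpace (𝓡 3) x} {U : Set M}

theorem IsAdaptedFrameOn.isOrthonormalFrameOn (h : IsAdaptedFrameOn g n n₂ n₃ U)
    (hn : IsDirectorField g n) : IsOrthonormalFrameOn g (adaptedFrame n n₂ n₃) U where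
  isOpen := h.isOpen
  smooth i := by
    fin_cases i
    · exact hn.smooth.contMDiffOn
    · exact h.smooth₂
    · exact h.smooth₃
  orthonormal x hx i j := by
    fin_cases i <;> fin_cases j <;>
      simp [hn.unit, h.unit₂ x hx, h.unit₃ x hx, h.orth₁₂ x hx, h.orth₁₃ x hx, h.orth₂₃ x hx,
        g.symm x (n₂ x) (n x), g.symm x (n₃ x) (n x), g.symm x (n₃ x) (n₂ x)]

/-- The Codazzi equations for a director field with constant modes: `a₁, a₂, a₃` are
the components of the connection form of the normal plane. -/
structure CodazziEquations (R₀ s t bp bx D₁ D₂ a₁ a₂ a₃ : ℝ) : Prop where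
  nn₂₂ : -(2 * D₂ * a₁) - bx * a₂ + bp ^ 2 + (s / 2 + D₁) ^ 2 + (D₂ ^ 2 - t ^ 2 / 4) + R₀ = 0
  nn₂₃ : 2 * D₁ * a₁ + bp * a₂ + bp * bx + (t / 2 + D₂) * s = 0
  nn₃₂ : 2 * D₁ * a₁ - bx * a₃ + bp * bx + (-t / 2 + D₂) * s = 0
  nn₃₃ : 2 * D₂ * a₁ + bp * a₃ + bx ^ 2 + (s / 2 - D₁) ^ 2 + (D₂ ^ 2 - t ^ 2 / 4) + R₀ = 0
  n₂n₃₂ : 2 * D₁ * a₂ + 2 * D₂ * a₃ - t * bp = 0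
  n₂n₃₃ : 2 * D₂ * a₂ - 2 * D₁ * a₃ - t * bx = 0

/-- The Gauss equation of the normal planes, for constant `a₁, a₂, a₃`. -/
def GaussEquation (R₀ s t D₁ D₂ a₁ a₂ a₃ : ℝ) : Prop :=
  s ^ 2 / 4 - (D₁ ^ 2 + D₂ ^ 2) + t ^ 2 / 4 + t * a₁ + a₂ ^ 2 + a₃ ^ 2 + R₀ = 0

variable {R₀ s t bp bx D₁ D₂ : ℝ}

/-- The column `k = 0` vanishes because `n` has unit length; the other entries invert the
definitions of the modes. -/
theorem connCoeff_director (hcov : IsLeviCivita g cov) (hn : IsDirectorField g n)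
    (h : IsAdaptedFrameOn g n n₂ n₃ U)
    (hm : ∀ x ∈ U,
      splay g cov n n₂ n₃ x = s ∧ twist g cov n n₂ n₃ x = t ∧
      g.inner x (bendVector cov n x) (n₂ x) = bp ∧
      g.inner x (bendVector cov n x) (n₃ x) = bx ∧
      biaxialSplay₁ g cov n n₂ n₃ x = D₁ ∧ biaxialSplay₂ g cov n n₂ n₃ x = D₂)
    {x : M} (hx : x ∈ U) (i k : Fin 3) :
    connCoeff g cov (adaptedFrame n n₂ n₃) i 0 k x =
      !![0, -bp, -bx; 0, s / 2 + D₁, t / 2 + D₂; 0, -t / 2 + D₂, s / 2 - D₁] i k := by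
  obtain ⟨h1, h2, h3, h4, h5, h6⟩ := hm x hx
  simp only [splay, twist, bendVector, biaxialSplay₁, biaxialSplay₂, gradComp, map_neg,
    neg_apply] at h1 h2 h3 h4 h5 h6
  have h0 := fun i => (h.isOrthonormalFrameOn hn).connCoeff_antisymm hcov hx i 0 0
  fin_cases k
  · have := h0 i
    fin_cases i <;> simp <;> simp at this <;> linarith
  · fin_cases i <;> simp [connCoeff] <;> linarith
  · fin_cases i <;> simp [connCoeff] <;> linarith

theorem codazziEquations (hcov : IsLeviCivita g cov) (hR : HasConstantCurvature g cov R₀)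
    (hn : IsDirectorField g n) (h : IsAdaptedFrameOn g n n₂ n₃ U)
    (hm : ∀ x ∈ U,
      splay g cov n n₂ n₃ x = s ∧ twist g cov n n₂ n₃ x = t ∧
      g.inner x (bendVector cov n x) (n₂ x) = bp ∧
      g.inner x (bendVector cov n x) (n₃ x) = bx ∧
      biaxialSplay₁ g cov n n₂ n₃ x = D₁ ∧ biaxialSplay₂ g cov n n₂ n₃ x = D₂)
    {x : M} (hx : x ∈ U) :
    CodazziEquations R₀ s t bp bx D₁ D₂ (connCoeff g cov (adaptedFrame n n₂ n₃) 0 1 2 x)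
      (connCoeff g cov (adaptedFrame n n₂ n₃) 1 1 2 x) (connCoeff g cov (adaptedFrame n n₂ n₃) 2 1 2 x) := by
  have hf := h.isOrthonormalFrameOn hn
  have h0 := fun {y} (hy : y ∈ U) => connCoeff_director hcov hn h hm hy
  have hC := hf.curvature_eq hcov hR hx (j := 0)
    (C := !![0, -bp, -bx; 0, s / 2 + D₁, t / 2 + D₂; 0, -t / 2 + D₂, s / 2 - D₁])
    (fun y hy => h0 hy)
  have ha := hf.connCoeff_antisymm hcov hx
  have e1 := hC 0 1 1
  have e2 := hC 0 1 2
  have e3 := hC 0 2 1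
  have e4 := hC 0 2 2
  have e5 := hC 1 2 1
  have e6 := hC 1 2 2
  have k11 : ∀ i, connCoeff g cov (adaptedFrame n n₂ n₃) i 1 1 x = 0 := fun i => by linarith [ha i 1 1]
  have k22 : ∀ i, connCoeff g cov (adaptedFrame n n₂ n₃) i 2 2 x = 0 := fun i => by linarith [ha i 2 2]
  simp only [Fin.sum_univ_three, h0 hx, ha _ 1 0, ha _ 2 0, ha _ 2 1, k11, k22] at e1 e2 e3 e4 e5 e6
  simp at e1 e2 e3 e4 e5 e6
  constructor <;> linarith

/-- Here the curvature acts on `n₂`, whose derivatives have the `a`'s among their components; hence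
the hypothesis that these are constant on `U`. -/
theorem gaussEquation (hcov : IsLeviCivita g cov) (hR : HasConstantCurvature g cov R₀)
    (hn : IsDirectorField g n) (h : IsAdaptedFrameOn g n n₂ n₃ U)
    (hm : ∀ x ∈ U,
      splay g cov n n₂ n₃ x = s ∧ twist g cov n n₂ n₃ x = t ∧
      g.inner x (bendVector cov n x) (n₂ x) = bp ∧
      g.inner x (bendVector cov n x) (n₃ x) = bx ∧
      biaxialSplay₁ g cov n n₂ n₃ x = D₁ ∧ biaxialSplay₂ g cov n n₂ n₃ x = D₂)
    {a₁ a₂ a₃ : ℝ} (ha : ∀ y ∈ U, connCoeff g cov (adaptedFrame n n₂ n₃) 0 1 2 y = a₁ ∧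
      connCoeff g cov (adaptedFrame n n₂ n₃) 1 1 2 y = a₂ ∧ connCoeff g cov (adaptedFrame n n₂ n₃) 2 1 2 y = a₃)
    {x : M} (hx : x ∈ U) : GaussEquation R₀ s t D₁ D₂ a₁ a₂ a₃ := by
  have hf := h.isOrthonormalFrameOn hn
  have h0 := fun {y} (hy : y ∈ U) => connCoeff_director hcov hn h hm hy
  have h1 : ∀ y ∈ U, ∀ i k, connCoeff g cov (adaptedFrame n n₂ n₃) i 1 k y =
      !![bp, 0, a₁; -(s / 2 + D₁), 0, a₂; -(-t / 2 + D₂), 0, a₃] i k := by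
    intro y hy i k
    obtain ⟨q1, q2, q3⟩ := ha y hy
    have hs := hf.connCoeff_antisymm hcov hy
    fin_cases k
    · have := hs i 1 0
      rw [h0 hy] at this
      fin_cases i <;> simp at this ⊢ <;> linarith
    · have := hs i 1 1
      fin_cases i <;> simp at this ⊢ <;> linarith
    · fin_cases i <;> simp <;> assumption
  have e := hf.curvature_eq hcov hR hx h1 1 2 2
  have hs := hf.connCoeff_antisymm hcov hx
  have k22 : ∀ i, connCoeff g cov (adaptedFrame n n₂ n₃) i 2 2 x = 0 := fun i => by linarith [hs i 2 2]
  simp only [Fin.sum_univ_three, h0 hx, hs _ 2 0, hs _ 2 1, h1 x hx, k22] at e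
  simp at e
  unfold GaussEquation
  linarith

end Uniform

/-! ### Elimination of the normal connection coefficients. -/

section Algebra

variable {R₀ s t bp bx D₁ D₂ a₁ a₂ a₃ : ℝ}

namespace CodazziEquations

/-- The last two Codazzi equations read 2D(a₂, a₃) = t𝐛, and D² = Δ², so applying D solves them. -/
theorem a₂_eq (h : CodazziEquations R₀ s t bp bx D₁ D₂ a₁ a₂ a₃) (hD : D₁ ^ 2 + D₂ ^ 2 ≠ 0) :
    a₂ = t * (D₁ * bp + D₂ * bx) / (2 * (D₁ ^ 2 + D₂ ^ 2)) := by
  rw [eq_div_iff (by positivity)]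
  linear_combination D₁ * h.n₂n₃₂ + D₂ * h.n₂n₃₃

theorem a₃_eq (h : CodazziEquations R₀ s t bp bx D₁ D₂ a₁ a₂ a₃) (hD : D₁ ^ 2 + D₂ ^ 2 ≠ 0) :
    a₃ = t * (D₂ * bp - D₁ * bx) / (2 * (D₁ ^ 2 + D₂ ^ 2)) := by
  rw [eq_div_iff (by positivity)]
  linear_combination D₂ * h.n₂n₃₂ - D₁ * h.n₂n₃₃

/-- The traceless symmetric part of the four `nn` equations contains a₁ with coefficients 4D₂, 4D₁.
One combination isolates a₁; the orthogonal one eliminates it and gives `splay_eq`. The trace gives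
`curvature_eq`. -/
theorem a₁_eq (h : CodazziEquations R₀ s t bp bx D₁ D₂ a₁ a₂ a₃) (hD : D₁ ^ 2 + D₂ ^ 2 ≠ 0) :
    a₁ = -(t * (bp ^ 2 + bx ^ 2) / 2 + formJDb bp bx D₁ D₂) / (4 * (D₁ ^ 2 + D₂ ^ 2)) := by
  rw [eq_div_iff (by positivity)]
  unfold formJDb
  linear_combination D₂ * (h.nn₃₃ - h.nn₂₂) + D₁ * (h.nn₂₃ + h.nn₃₂)
    - bp / 2 * h.n₂n₃₂ - bx / 2 * h.n₂n₃₃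

theorem splay_eq (h : CodazziEquations R₀ s t bp bx D₁ D₂ a₁ a₂ a₃) :
    2 * (D₁ ^ 2 + D₂ ^ 2) * s = -formDb bp bx D₁ D₂ := by
  unfold formDb
  linear_combination -D₁ * (h.nn₃₃ - h.nn₂₂) + D₂ * (h.nn₂₃ + h.nn₃₂)
    + bx / 2 * h.n₂n₃₂ - bp / 2 * h.n₂n₃₃

theorem curvature_eq (h : CodazziEquations R₀ s t bp bx D₁ D₂ a₁ a₂ a₃) :
    2 * (D₁ ^ 2 + D₂ ^ 2) * (2 * R₀) = 2 * (D₁ ^ 2 + D₂ ^ 2) * (-(bp ^ 2 + bx ^ 2) - s ^ 2 / 2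
      - 2 * (D₁ ^ 2 + D₂ ^ 2) + t ^ 2 / 2) + t * formJDb bp bx D₁ D₂ := by
  unfold formJDb
  linear_combination 2 * (D₁ ^ 2 + D₂ ^ 2) * (h.nn₂₂ + h.nn₃₃)
    + bx * (D₁ * h.n₂n₃₂ + D₂ * h.n₂n₃₃) - bp * (D₂ * h.n₂n₃₂ - D₁ * h.n₂n₃₃)

theorem twist_sq (h : CodazziEquations R₀ s t bp bx D₁ D₂ a₁ a₂ a₃)
    (hG : GaussEquation R₀ s t D₁ D₂ a₁ a₂ a₃) (hD : D₁ ^ 2 + D₂ ^ 2 ≠ 0) :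
    t ^ 2 = 4 * (D₁ ^ 2 + D₂ ^ 2) := by
  have h1 := h.a₁_eq hD
  rw [eq_div_iff (by positivity)] at h1
  have key : (t ^ 2 - 4 * (D₁ ^ 2 + D₂ ^ 2)) * (4 * (D₁ ^ 2 + D₂ ^ 2) + (bp ^ 2 + bx ^ 2)) = 0 := by
    -- Multiplying the two `n₂n₃` equations by their conjugates and adding gives 4Δ²(a₂² + a₃²) =
    -- t²b²; the trace equation removes R₀.
    unfold GaussEquation at hG
    linear_combination 8 * (D₁ ^ 2 + D₂ ^ 2) * hG - 2 * h.curvature_eq - 2 * t * h1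
      - 2 * (2 * D₁ * a₂ + 2 * D₂ * a₃ + t * bp) * h.n₂n₃₂
      - 2 * (2 * D₂ * a₂ - 2 * D₁ * a₃ + t * bx) * h.n₂n₃₃
  have hp : 0 < D₁ ^ 2 + D₂ ^ 2 := by positivity
  rcases mul_eq_zero.1 key with h | h
  · linarith
  · nlinarith [sq_nonneg bp, sq_nonneg bx]

end CodazziEquations
end Algebra

/-! ### Algebraic consequences: inequalities, the bend angle, and the case Δ = 0. -/

section Algebra

variable {R₀ s t bp bx D₁ D₂ : ℝ}

theorem bendNorm_sq : bendNorm bp bx ^ 2 = bp ^ 2 + bx ^ 2 := Real.sq_sqrt (by positivity)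

theorem splayNorm_sq : splayNorm D₁ D₂ ^ 2 = D₁ ^ 2 + D₂ ^ 2 := Real.sq_sqrt (by positivity)

theorem splayNorm_eq_zero : splayNorm D₁ D₂ = 0 ↔ D₁ = 0 ∧ D₂ = 0 := by
  rw [← sq_eq_zero_iff, splayNorm_sq]
  exact ⟨fun h => ⟨by nlinarith [sq_nonneg D₁, sq_nonneg D₂], by nlinarith [sq_nonneg D₁, sq_nonneg D₂]⟩,
    fun h => by simp [h]⟩

theorem bendNorm_eq_zero : bendNorm bp bx = 0 ↔ bp = 0 ∧ bx = 0 := splayNorm_eq_zero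

theorem eq_or_eq_neg_splayNorm (h : t ^ 2 = 4 * (D₁ ^ 2 + D₂ ^ 2)) :
    t = 2 * splayNorm D₁ D₂ ∨ t = -(2 * splayNorm D₁ D₂) := by
  rw [← sq_eq_sq_iff_eq_or_eq_neg, h, ← splayNorm_sq]
  ring

/-- The relations between the modes when the biaxial splay does not vanish. -/
structure BiaxialModes (R₀ s t bp bx D₁ D₂ : ℝ) : Prop where
  twist : t ^ 2 = 4 * (D₁ ^ 2 + D₂ ^ 2)
  splay : 2 * (D₁ ^ 2 + D₂ ^ 2) * s = -formDb bp bx D₁ D₂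
  curvature : 2 * (D₁ ^ 2 + D₂ ^ 2) * (2 * R₀) =
    2 * (D₁ ^ 2 + D₂ ^ 2) * (-(bp ^ 2 + bx ^ 2) - s ^ 2 / 2) + t * formJDb bp bx D₁ D₂

theorem form_sq_add_sq : formDb bp bx D₁ D₂ ^ 2 + formJDb bp bx D₁ D₂ ^ 2 =
    (D₁ ^ 2 + D₂ ^ 2) * (bp ^ 2 + bx ^ 2) ^ 2 := by
  unfold formDb formJDb; ring

namespace BiaxialModes

theorem splay_eq (h : BiaxialModes R₀ s t bp bx D₁ D₂) (hD : splayNorm D₁ D₂ ≠ 0) :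
    s = -(formDb bp bx D₁ D₂ / (2 * splayNorm D₁ D₂ ^ 2)) := by
  have := h.splay
  rw [← splayNorm_sq] at this
  field_simp
  linarith

theorem two_mul_curvature (h : BiaxialModes R₀ s t bp bx D₁ D₂) (hD : splayNorm D₁ D₂ ≠ 0) :
    2 * R₀ = -bendNorm bp bx ^ 2 - s ^ 2 / 2 +
      t * formJDb bp bx D₁ D₂ / (2 * splayNorm D₁ D₂ ^ 2) := by
  have := h.curvature
  rw [← splayNorm_sq, ← bendNorm_sq] at this
  field_simp
  linarith

theorem of_eq (hD : splayNorm D₁ D₂ ≠ 0)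
    (ht : t = 2 * splayNorm D₁ D₂ ∨ t = -(2 * splayNorm D₁ D₂))
    (hs : s = -(formDb bp bx D₁ D₂ / (2 * splayNorm D₁ D₂ ^ 2)))
    (hR : 2 * R₀ = -bendNorm bp bx ^ 2 - s ^ 2 / 2 +
      t * formJDb bp bx D₁ D₂ / (2 * splayNorm D₁ D₂ ^ 2)) :
    BiaxialModes R₀ s t bp bx D₁ D₂ where
  twist := by
    rw [← splayNorm_sq]
    rcases ht with rfl | rfl <;> ring
  splay := by
    rw [← splayNorm_sq, hs]
    field_simp
  curvature := by
    rw [← splayNorm_sq, ← bendNorm_sq, hR]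
    field_simp

theorem sqrt_le (h : BiaxialModes R₀ s t bp bx D₁ D₂) (hD : splayNorm D₁ D₂ ≠ 0) :
    Real.sqrt (-R₀ / splayNorm D₁ D₂ ^ 2) ≤
      1 + bendNorm bp bx ^ 2 / (4 * splayNorm D₁ D₂ ^ 2) := by
  have hp : 0 < splayNorm D₁ D₂ ^ 2 := by positivity
  refine Real.sqrt_le_iff.2 ⟨by positivity, ?_⟩
  -- The difference of squares is itself a perfect square once s is eliminated through
  -- `form_sq_add_sq` and t² = 4Δ² is used.
  have e : (1 + bendNorm bp bx ^ 2 / (4 * splayNorm D₁ D₂ ^ 2)) ^ 2 - -R₀ / splayNorm D₁ D₂ ^ 2 =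
      (1 + t * formJDb bp bx D₁ D₂ / (8 * (splayNorm D₁ D₂ ^ 2) ^ 2)) ^ 2 := by
    have h1 := h.twist
    have h2 := h.splay_eq hD
    have h3 := h.two_mul_curvature hD
    have h4 := form_sq_add_sq (bp := bp) (bx := bx) (D₁ := D₁) (D₂ := D₂)
    rw [← splayNorm_sq] at h1
    rw [← splayNorm_sq (D₁ := D₁), ← bendNorm_sq (bp := bp)] at h4
    rw [h2] at h3
    generalize splayNorm D₁ D₂ = d at *
    generalize bendNorm bp bx = b at *
    generalize formJDb bp bx D₁ D₂ = J at *
    generalize formDb bp bx D₁ D₂ = F at *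
    have h5 : F ^ 2 = d ^ 2 * (b ^ 2) ^ 2 - J ^ 2 := by linarith
    have h6 : R₀ = (-b ^ 2 - (d ^ 2 * (b ^ 2) ^ 2 - J ^ 2) / (8 * d ^ 4)
      + t * J / (2 * d ^ 2)) / 2 := by
      rw [← h5]
      have : (-(F / (2 * d ^ 2))) ^ 2 / 2 = F ^ 2 / (8 * d ^ 4) := by field_simp; ring
      linarith
    rw [h6]
    linear_combination (norm := (field_simp; ring)) -(J ^ 2 / (64 * d ^ 8)) * h1
  nlinarith [sq_nonneg (1 + t * formJDb bp bx D₁ D₂ / (8 * (splayNorm D₁ D₂ ^ 2) ^ 2))]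

/-- By `form_sq_add_sq`, |⟨JD𝐛,𝐛⟩| ≤ Δb², so the last term of (*) is at most b² and is absorbed by
-b². -/
theorem curvature_le (h : BiaxialModes R₀ s t bp bx D₁ D₂) (hD : splayNorm D₁ D₂ ≠ 0) :
    4 * R₀ ≤ -s ^ 2 := by
  have h4 := form_sq_add_sq (bp := bp) (bx := bx) (D₁ := D₁) (D₂ := D₂)
  have h3 := h.curvature
  have h1 := h.twist
  rw [← splayNorm_sq] at h1 h3
  rw [← splayNorm_sq (D₁ := D₁)] at h4
  have hp : 0 < splayNorm D₁ D₂ ^ 2 := by positivity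
  generalize splayNorm D₁ D₂ = d at *
  generalize formJDb bp bx D₁ D₂ = J at *
  have h5 : t * J ≤ 2 * d ^ 2 * (bp ^ 2 + bx ^ 2) := by
    refine le_of_abs_le (abs_le_of_sq_le_sq ?_ (by positivity))
    have : J ^ 2 ≤ d ^ 2 * (bp ^ 2 + bx ^ 2) ^ 2 := by
      linarith [sq_nonneg (formDb bp bx D₁ D₂)]
    calc (t * J) ^ 2 = 4 * d ^ 2 * J ^ 2 := by rw [mul_pow, h1]
      _ ≤ 4 * d ^ 2 * (d ^ 2 * (bp ^ 2 + bx ^ 2) ^ 2) := by gcongr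
      _ = (2 * d ^ 2 * (bp ^ 2 + bx ^ 2)) ^ 2 := by ring
  refine le_of_mul_le_mul_left ?_ hp
  linarith

end BiaxialModes

/-- The components of `D` and of the forms in the frame of the principal directions. -/
theorem IsBendAngle.forms {φ : ℝ} (h : IsBendAngle bp bx D₁ D₂ φ) :
    formDb bp bx D₁ D₂ = splayNorm D₁ D₂ * bendNorm bp bx ^ 2 * Real.cos (2 * φ) ∧
    formJDb bp bx D₁ D₂ = splayNorm D₁ D₂ * bendNorm bp bx ^ 2 * Real.sin (2 * φ) := by
  obtain ⟨-, -, -, e₁, e₂, he, h1, h2, h3, h4⟩ := h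
  -- These are the entries of D = Δ(e ⊗ e - Je ⊗ Je).
  have k1 : D₁ = splayNorm D₁ D₂ * (e₁ ^ 2 - e₂ ^ 2) := by
    linear_combination -D₁ * he + e₁ * h1 - e₂ * h2
  have k2 : D₂ = splayNorm D₁ D₂ * (2 * e₁ * e₂) := by
    linear_combination -D₂ * he + e₂ * h1 + e₁ * h2
  generalize splayNorm D₁ D₂ = d at *
  generalize bendNorm bp bx = b at *
  subst k1 k2 h3 h4
  rw [Real.cos_two_mul', Real.sin_two_mul]
  unfold formDb formJDb
  have he2 : (e₁ ^ 2 + e₂ ^ 2) ^ 2 = 1 := by rw [he]; norm_num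
  constructor
  · linear_combination d * b ^ 2 * (Real.cos φ ^ 2 - Real.sin φ ^ 2) * he2
  · linear_combination d * b ^ 2 * (2 * Real.sin φ * Real.cos φ) * he2

theorem exists_polar (x y : ℝ) : ∃ θ : ℝ, 0 ≤ θ ∧ θ < 2 * Real.pi ∧
    x = Real.sqrt (x ^ 2 + y ^ 2) * Real.cos θ ∧ y = Real.sqrt (x ^ 2 + y ^ 2) * Real.sin θ := by
  have hn : ‖(⟨x, y⟩ : ℂ)‖ = Real.sqrt (x ^ 2 + y ^ 2) := by
    rw [Complex.norm_def, Complex.normSq_mk]; ring_nf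
  have hc := Complex.norm_mul_cos_arg (⟨x, y⟩ : ℂ)
  have hs := Complex.norm_mul_sin_arg (⟨x, y⟩ : ℂ)
  rw [hn] at hc hs
  have h1 := Complex.neg_pi_lt_arg (⟨x, y⟩ : ℂ)
  have h2 := Complex.arg_le_pi (⟨x, y⟩ : ℂ)
  have hpi := Real.pi_pos
  by_cases h : 0 ≤ Complex.arg (⟨x, y⟩ : ℂ)
  · exact ⟨_, h, by linarith, hc.symm, hs.symm⟩
  · refine ⟨Complex.arg (⟨x, y⟩ : ℂ) + 2 * Real.pi, by linarith, by linarith, ?_, ?_⟩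
    · rw [Real.cos_add_two_pi]; exact hc.symm
    · rw [Real.sin_add_two_pi]; exact hs.symm

/-- A principal direction of the biaxial splay. -/
theorem exists_principal (D₁ D₂ : ℝ) : ∃ e₁ e₂ : ℝ, e₁ ^ 2 + e₂ ^ 2 = 1 ∧
    D₁ = splayNorm D₁ D₂ * (e₁ ^ 2 - e₂ ^ 2) ∧ D₂ = splayNorm D₁ D₂ * (2 * e₁ * e₂) := by
  obtain ⟨θ, -, -, hc, hs⟩ := exists_polar D₁ D₂
  -- The principal direction has half the polar angle of (Δ₁, Δ₂).
  refine ⟨Real.cos (θ / 2), Real.sin (θ / 2), Real.cos_sq_add_sin_sq _, ?_, ?_⟩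
  · rw [← Real.cos_two_mul', mul_div_cancel₀ _ two_ne_zero]; exact hc
  · rw [mul_right_comm, ← Real.sin_two_mul, mul_div_cancel₀ _ two_ne_zero]; exact hs

theorem exists_isBendAngle (hb : bendNorm bp bx ≠ 0) (D₁ D₂ : ℝ) :
    ∃ φ, IsBendAngle bp bx D₁ D₂ φ := by
  obtain ⟨e₁, e₂, he, h1, h2⟩ := exists_principal D₁ D₂
  obtain ⟨φ, h0, h2pi, hc, hs⟩ := exists_polar (e₁ * bp + e₂ * bx) (e₁ * bx - e₂ * bp)
  have hn : Real.sqrt ((e₁ * bp + e₂ * bx) ^ 2 + (e₁ * bx - e₂ * bp) ^ 2) = bendNorm bp bx := by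
    unfold bendNorm
    congr 1
    linear_combination (bp ^ 2 + bx ^ 2) * he
  rw [hn] at hc hs
  refine ⟨φ, hb, h0, h2pi, e₁, e₂, he, ?_, ?_, ?_, ?_⟩
  · linear_combination e₁ * h1 + e₂ * h2 + splayNorm D₁ D₂ * e₁ * he
  · linear_combination e₁ * h2 - e₂ * h1 + splayNorm D₁ D₂ * e₂ * he
  · linear_combination -bp * he + e₁ * hc - e₂ * hs
  · linear_combination -bx * he + e₂ * hc + e₁ * hs

theorem BiaxialModes.bendBisects (h : BiaxialModes 0 s t bp bx D₁ D₂) (hD : splayNorm D₁ D₂ ≠ 0)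
    (hs : s = 0) : BendBisects t bp bx D₁ D₂ := by
  intro φ hφ
  obtain ⟨-, hJ⟩ := hφ.forms
  obtain ⟨hb, h0, h2pi, -⟩ := hφ
  have hR := h.two_mul_curvature hD
  rw [hJ, hs, Real.sin_two_mul] at hR
  have hpi := Real.pi_pos
  have hsc := Real.sin_sq_add_cos_sq φ
  rcases eq_or_eq_neg_splayNorm h.twist with ht | ht
  · rw [ht] at hR
    -- Equation (*) with R₀ = s = 0 says sin 2φ = 1, equivalently (sin φ - cos φ)² = 0.
    have hx : 2 * Real.sin φ * Real.cos φ = 1 := by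
      field_simp at hR
      refine mul_left_cancel₀ (pow_ne_zero 2 hb) ?_
      linarith
    have : Real.sin (φ - Real.pi / 4) = 0 := by
      rw [Real.sin_sub, Real.sin_pi_div_four, Real.cos_pi_div_four, ← sub_mul]
      have : Real.sin φ - Real.cos φ = 0 := by
        rw [← sq_eq_zero_iff]
        nlinarith
      rw [this, zero_mul]
    obtain ⟨m, hm⟩ := Real.sin_eq_zero_iff.1 this
    have m1 : -1 < m := by
      have : (-1 : ℝ) < m := by nlinarith
      exact_mod_cast this
    have m2 : m < 2 := by
      have : (m : ℝ) < 2 := by nlinarith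
      exact_mod_cast this
    obtain rfl | rfl : m = 0 ∨ m = 1 := by omega
    -- From φ = π/4 + mπ the index is k = 2m; for negative twist below, φ = mπ - π/4 gives k = 2m -
    -- 1.
    · exact ⟨0, by push_cast at hm ⊢; linarith, Or.inl ⟨ht, Or.inl rfl⟩⟩
    · exact ⟨2, by push_cast at hm ⊢; linarith, Or.inl ⟨ht, Or.inr rfl⟩⟩
  · rw [ht] at hR
    have hx : 2 * Real.sin φ * Real.cos φ = -1 := by
      field_simp at hR
      refine mul_left_cancel₀ (pow_ne_zero 2 hb) ?_
      linarith
    have : Real.sin (φ + Real.pi / 4) = 0 := by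
      rw [Real.sin_add, Real.sin_pi_div_four, Real.cos_pi_div_four, ← add_mul]
      have : Real.sin φ + Real.cos φ = 0 := by
        rw [← sq_eq_zero_iff]
        nlinarith
      rw [this, zero_mul]
    obtain ⟨m, hm⟩ := Real.sin_eq_zero_iff.1 this
    have m1 : 0 < m := by
      have : (0 : ℝ) < m := by nlinarith
      exact_mod_cast this
    have m2 : m < 3 := by
      have : (m : ℝ) < 3 := by nlinarith
      exact_mod_cast this
    obtain rfl | rfl : m = 1 ∨ m = 2 := by omega
    · exact ⟨1, by push_cast at hm ⊢; linarith, Or.inr ⟨ht, Or.inl rfl⟩⟩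
    · exact ⟨3, by push_cast at hm ⊢; linarith, Or.inr ⟨ht, Or.inr rfl⟩⟩

/-- `BendBisects` quantifies over all bend angles, so it has content only because
`exists_isBendAngle` supplies one. Then 2φ = kπ + π/2, which gives cos 2φ = 0 and sin 2φ = (-1)^k.
-/
theorem BendBisects.biaxialModes (h : BendBisects t bp bx D₁ D₂) (hD : splayNorm D₁ D₂ ≠ 0)
    (ht : t = 2 * splayNorm D₁ D₂ ∨ t = -(2 * splayNorm D₁ D₂)) :
    BiaxialModes 0 0 t bp bx D₁ D₂ := by
  have key : formDb bp bx D₁ D₂ = 0 ∧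
      t * formJDb bp bx D₁ D₂ = 2 * splayNorm D₁ D₂ ^ 2 * bendNorm bp bx ^ 2 := by
    by_cases hb : bendNorm bp bx = 0
    · obtain ⟨rfl, rfl⟩ := bendNorm_eq_zero.1 hb
      simp [formDb, formJDb, hb]
    obtain ⟨φ, hφ⟩ := exists_isBendAngle hb D₁ D₂
    obtain ⟨k, hk, hc⟩ := h φ hφ
    obtain ⟨hF, hJ⟩ := hφ.forms
    have h2 : 2 * φ = k * Real.pi + Real.pi / 2 := by rw [hk]; ring
    rw [h2, Real.cos_add_pi_div_two, Real.sin_nat_mul_pi] at hF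
    rw [h2, Real.sin_add_pi_div_two, Real.cos_nat_mul_pi] at hJ
    refine ⟨by rw [hF]; ring, ?_⟩
    rw [hJ]
    rcases hc with ⟨ht, rfl | rfl⟩ | ⟨ht, rfl | rfl⟩ <;> rw [ht] <;> ring
  refine .of_eq hD ht (by simp [key.1]) ?_
  rw [key.2]
  field_simp
  ring

theorem CodazziEquations.of_splayNorm_eq_zero {a₁ a₂ a₃ : ℝ}
    (h : CodazziEquations R₀ s t bp bx D₁ D₂ a₁ a₂ a₃) (hD : splayNorm D₁ D₂ = 0) :
    (bendNorm bp bx = 0 ∧ s * t = 0 ∧ s ^ 2 - t ^ 2 + 4 * R₀ = 0) ∨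
    (bendNorm bp bx ≠ 0 ∧ t = 0 ∧ s ^ 2 + 4 * bendNorm bp bx ^ 2 = -(4 * R₀)) := by
  obtain ⟨rfl, rfl⟩ := splayNorm_eq_zero.1 hD
  obtain ⟨h1, h2, h3, h4, h5, h6⟩ := h
  by_cases hb : bendNorm bp bx = 0
  · refine Or.inl ⟨hb, ?_⟩
    obtain ⟨rfl, rfl⟩ := bendNorm_eq_zero.1 hb
    exact ⟨by linarith, by linarith⟩
  · refine Or.inr ⟨hb, ?_⟩
    rw [bendNorm_sq]
    have ht : t = 0 := by
      by_contra ht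
      apply hb
      rw [bendNorm_eq_zero]
      constructor
      · exact (mul_eq_zero.1 (by linarith : t * bp = 0)).resolve_left ht
      · exact (mul_eq_zero.1 (by linarith : t * bx = 0)).resolve_left ht
    subst ht
    refine ⟨rfl, ?_⟩
    by_cases hx : bx = 0
    · subst hx
      linarith
    -- With t = 0 and D = 0 the equation `nn₃₂` is bx(bp - a₃) = 0.
    · have : a₃ = bp := by
        have : bx * (a₃ - bp) = 0 := by linarith
        linarith [(mul_eq_zero.1 this).resolve_left hx]
      subst this
      linarith

end Algebra

/-! ### Necessity: the classification by the sign of R₀. -/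

section Uniform

variable {M : Type*} [TopologicalSpace M] [ChartedSpace E3 M] [IsManifold (𝓡 3) ∞ M] [Nonempty M]
  {g : Metric3 M} {cov : Connection3 M} {n : Π x : M, TangentSpace (𝓡 3) x}
  {R₀ s t bp bx D₁ D₂ : ℝ}

theorem IsUniformDistortion.exists_codazziEquations
    (h : IsUniformDistortion g cov n R₀ s t bp bx D₁ D₂) :
    ∃ a₁ a₂ a₃, CodazziEquations R₀ s t bp bx D₁ D₂ a₁ a₂ a₃ := by
  obtain ⟨p⟩ := ‹Nonempty M›
  obtain ⟨U, hp, n₂, n₃, hf, hm⟩ := h.modes p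
  exact ⟨_, _, _, codazziEquations h.leviCivita h.curvature h.director hf hm hp⟩

theorem IsUniformDistortion.biaxialModes
    (h : IsUniformDistortion g cov n R₀ s t bp bx D₁ D₂) (hD : splayNorm D₁ D₂ ≠ 0) :
    BiaxialModes R₀ s t bp bx D₁ D₂ := by
  obtain ⟨p⟩ := ‹Nonempty M›
  obtain ⟨U, hp, n₂, n₃, hf, hm⟩ := h.modes p
  have hC := fun {y} (hy : y ∈ U) =>
    codazziEquations h.leviCivita h.curvature h.director hf hm hy
  have hD' : D₁ ^ 2 + D₂ ^ 2 ≠ 0 := by rw [← splayNorm_sq]; positivity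
  -- The formulas for the `a`'s involve only constants, so their values at `y` and at `p` agree.
  have hG := gaussEquation h.leviCivita h.curvature h.director hf hm
    (fun y hy => ⟨((hC hy).a₁_eq hD').trans ((hC hp).a₁_eq hD').symm,
      ((hC hy).a₂_eq hD').trans ((hC hp).a₂_eq hD').symm,
      ((hC hy).a₃_eq hD').trans ((hC hp).a₃_eq hD').symm⟩) hp
  have ht := (hC hp).twist_sq hG hD'
  refine ⟨ht, (hC hp).splay_eq, ?_⟩
  rw [(hC hp).curvature_eq, ht]
  ring

theorem IsUniformDistortion.of_pos (h : IsUniformDistortion g cov n R₀ s t bp bx D₁ D₂)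
    (hR : 0 < R₀) : s = 0 ∧ bendNorm bp bx = 0 ∧ splayNorm D₁ D₂ = 0 ∧
      (t = 2 * Real.sqrt R₀ ∨ t = -(2 * Real.sqrt R₀)) := by
  have hD : splayNorm D₁ D₂ = 0 := by
    by_contra hD
    exact absurd ((h.biaxialModes hD).curvature_le hD) (by nlinarith [sq_nonneg s])
  obtain ⟨a₁, a₂, a₃, hC⟩ := h.exists_codazziEquations
  rcases hC.of_splayNorm_eq_zero hD with ⟨hb, hst, hq⟩ | ⟨hb, ht, hq⟩
  · rcases mul_eq_zero.1 hst with hs | ht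
    · refine ⟨hs, hb, hD, ?_⟩
      rw [← sq_eq_sq_iff_eq_or_eq_neg, mul_pow, Real.sq_sqrt hR.le]
      rw [hs] at hq
      linarith
    · rw [ht] at hq
      nlinarith [sq_nonneg s]
  · nlinarith [sq_nonneg s, sq_nonneg (bendNorm bp bx)]

theorem IsUniformDistortion.of_zero (h : IsUniformDistortion g cov n R₀ s t bp bx D₁ D₂)
    (hR : R₀ = 0) :
    (splayNorm D₁ D₂ = 0 → bendNorm bp bx = 0 ∧ s = 0 ∧ t = 0) ∧
    (splayNorm D₁ D₂ ≠ 0 → s = 0 ∧ (t = 2 * splayNorm D₁ D₂ ∨ t = -(2 * splayNorm D₁ D₂)) ∧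
      BendBisects t bp bx D₁ D₂) := by
  subst hR
  constructor
  · intro hD
    obtain ⟨a₁, a₂, a₃, hC⟩ := h.exists_codazziEquations
    rcases hC.of_splayNorm_eq_zero hD with ⟨hb, hst, hq⟩ | ⟨hb, ht, hq⟩
    · refine ⟨hb, ?_⟩
      rcases mul_eq_zero.1 hst with rfl | rfl
      · exact ⟨rfl, by nlinarith⟩
      · exact ⟨by nlinarith, rfl⟩
    · have : 0 < bendNorm bp bx ^ 2 := by positivity
      nlinarith [sq_nonneg s]
  · intro hD
    have hB := h.biaxialModes hD
    have hs : s = 0 := by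
      have := hB.curvature_le hD
      exact sq_eq_zero_iff.1 (le_antisymm (by linarith) (sq_nonneg s))
    exact ⟨hs, eq_or_eq_neg_splayNorm hB.twist, hB.bendBisects hD hs⟩

theorem IsUniformDistortion.of_neg (h : IsUniformDistortion g cov n R₀ s t bp bx D₁ D₂)
    (hR : R₀ < 0) :
    (splayNorm D₁ D₂ = 0 → t = 0 ∧ s ^ 2 + 4 * bendNorm bp bx ^ 2 = -(4 * R₀)) ∧
    (splayNorm D₁ D₂ ≠ 0 →
      (t = 2 * splayNorm D₁ D₂ ∨ t = -(2 * splayNorm D₁ D₂)) ∧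
      s = -(formDb bp bx D₁ D₂ / (2 * splayNorm D₁ D₂ ^ 2)) ∧
      1 + bendNorm bp bx ^ 2 / (4 * splayNorm D₁ D₂ ^ 2) ≥
        Real.sqrt (-R₀ / splayNorm D₁ D₂ ^ 2) ∧
      2 * R₀ = -bendNorm bp bx ^ 2 - s ^ 2 / 2 +
        t * formJDb bp bx D₁ D₂ / (2 * splayNorm D₁ D₂ ^ 2)) := by
  constructor
  · intro hD
    obtain ⟨a₁, a₂, a₃, hC⟩ := h.exists_codazziEquations
    rcases hC.of_splayNorm_eq_zero hD with ⟨hb, hst, hq⟩ | ⟨hb, ht, hq⟩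
    · rcases mul_eq_zero.1 hst with rfl | rfl
      · nlinarith [sq_nonneg t]
      · rw [hb]
        exact ⟨rfl, by linarith⟩
    · exact ⟨ht, hq⟩
  · intro hD
    have hB := h.biaxialModes hD
    exact ⟨eq_or_eq_neg_splayNorm hB.twist, hB.splay_eq hD, hB.sqrt_le hD,
      hB.two_mul_curvature hD⟩

end Uniform

/-! ### Riemannian geometry of a global frame with constant structure functions. -/

section ParallelFrame

/-- A smooth parallelization of `E3`: the isomorphism `toFun x` sends the standard basis to a frame
at `x`, and `invFun x` computes the components of vectors in this frame. -/
structure Parallelization where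
  /-- The vector with given components. -/
  toFun : E3 → E3 →L[ℝ] E3
  /-- The components of a vector. -/
  invFun : E3 → E3 →L[ℝ] E3
  contDiff_toFun : ContDiff ℝ ∞ toFun
  contDiff_invFun : ContDiff ℝ ∞ invFun
  left_inv : ∀ x v, invFun x (toFun x v) = v
  right_inv : ∀ x v, toFun x (invFun x v) = v

namespace Parallelization

variable (P : Parallelization)

/-- The metric for which the frame is orthonormal. -/
def innerFun (x : E3) : E3 →L[ℝ] E3 →L[ℝ] ℝ :=
  (innerSL ℝ).bilinearComp (P.invFun x) (P.invFun x)

theorem innerFun_apply (x v w : E3) :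
    P.innerFun x v w = inner ℝ (P.invFun x v) (P.invFun x w) := rfl

theorem contDiff_innerFun : ContDiff ℝ ∞ P.innerFun := by
  have h : P.innerFun = fun x =>
      ((ContinuousLinearMap.compL ℝ E3 E3 ℝ).flip (P.invFun x)) ∘L ((innerSL ℝ) ∘L (P.invFun x)) := by
    ext x v w
    rfl
  rw [h]
  have := P.contDiff_invFun
  fun_prop

theorem isVonNBounded_innerFun (x : E3) :
    Bornology.IsVonNBounded ℝ {v : E3 | P.innerFun x v v < 1} := by
  -- The unit ball of the metric lies in the image of the Euclidean one under `P.toFun x`.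
  refine ((NormedSpace.isVonNBounded_ball ℝ E3 1).image (P.toFun x)).subset fun v hv => ?_
  refine ⟨P.invFun x v, ?_, P.right_inv x v⟩
  rw [mem_ofPred_eq, innerFun_apply, real_inner_self_eq_norm_sq] at hv
  rw [mem_ball_zero_iff]
  nlinarith [norm_nonneg (P.invFun x v)]

theorem innerFun_pos (x v : E3) (hv : v ≠ 0) : 0 < P.innerFun x v v := by
  rw [innerFun_apply]
  refine real_inner_self_pos.2 fun h => hv ?_
  rw [← P.right_inv x v, h, map_zero]

theorem trivializationAt_snd (x : E3) (p : TangentBundle (𝓡 3) E3) :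
    (trivializationAt E3 (TangentSpace (𝓡 3)) x p).2 = p.2 :=
  congrArg Prod.snd (trivializationAt_model_space_apply p x)

theorem trivializationAt_cotangent_snd (x y : E3) (φ : TangentSpace (𝓡 3) y →L[ℝ] ℝ) :
    (trivializationAt (E3 →L[ℝ] ℝ) (fun b : E3 => TangentSpace (𝓡 3) b →L[ℝ] ℝ) x
      (TotalSpace.mk' (E3 →L[ℝ] ℝ) y φ)).2 = φ := by
  rw [hom_trivializationAt_apply]
  refine ContinuousLinearMap.ext fun v => ?_
  simp [ContinuousLinearMap.inCoordinates]
  rfl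

/-- Trivializations over the model space are the identity on fibres, so smoothness of the metric as
a section reduces to `contDiff_innerFun`. -/
theorem trivializationAt_bilin_snd (x y : E3)
    (φ : TangentSpace (𝓡 3) y →L[ℝ] TangentSpace (𝓡 3) y →L[ℝ] ℝ) :
    (trivializationAt (E3 →L[ℝ] E3 →L[ℝ] ℝ)
      (fun b : E3 => TangentSpace (𝓡 3) b →L[ℝ] TangentSpace (𝓡 3) b →L[ℝ] ℝ) x
      (TotalSpace.mk' (E3 →L[ℝ] E3 →L[ℝ] ℝ) y φ)).2 = φ := by
  rw [hom_trivializationAt_apply]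
  refine ContinuousLinearMap.ext fun v => ?_
  have hy : y ∈ (trivializationAt (E3 →L[ℝ] ℝ)
      (fun b : E3 => TangentSpace (𝓡 3) b →L[ℝ] ℝ) x).baseSet := by
    simp
    exact mem_univ y
  simp only [ContinuousLinearMap.inCoordinates, ContinuousLinearMap.comp_apply,
    Trivialization.continuousLinearMapAt_apply, TangentBundle.symmL_model_space,
    Trivialization.coe_linearMapAt_of_mem _ hy]
  exact trivializationAt_cotangent_snd x y _

/-- The Riemannian metric for which the frame is orthonormal. -/
def metric : Metric3 E3 where
  inner x := P.innerFun x
  symm x v w := real_inner_comm (P.invFun x w) (P.invFun x v)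
  pos x v hv := P.innerFun_pos x v hv
  isVonNBounded x := P.isVonNBounded_innerFun x
  contMDiff := fun x => (contMDiffAt_section (F := E3 →L[ℝ] E3 →L[ℝ] ℝ)
      (E := fun b : E3 => TangentSpace (𝓡 3) b →L[ℝ] TangentSpace (𝓡 3) b →L[ℝ] ℝ)
      (s := fun y => P.innerFun y) x).2 <|
    P.contDiff_innerFun.contDiffAt.contMDiffAt.congr_of_eventuallyEq <|
      Eventually.of_forall fun y => trivializationAt_bilin_snd x y _

theorem mdiff_iff {Y : Π x : E3, TangentSpace (𝓡 3) x} {x : E3} :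
    MDifferentiableAt (𝓡 3) ((𝓡 3).prod 𝓘(ℝ, E3)) (asSection Y) x ↔
      DifferentiableAt ℝ (Y : E3 → E3) x := by
  have : (fun y => (trivializationAt E3 (TangentSpace (𝓡 3)) x (asSection Y y)).2) = (Y : E3 → E3) :=
    funext fun y => trivializationAt_snd x _
  refine (mdifferentiableAt_section (E := fun y : E3 => TangentSpace (𝓡 3) y) (𝓡 3) Y).trans ?_
  exact (iff_of_eq (congrArg (fun f => MDifferentiableAt (𝓡 3) 𝓘(ℝ, E3) f x) this)).trans mdifferentiableAt_iff_differentiableAt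

theorem cmdiff_iff {Y : Π x : E3, TangentSpace (𝓡 3) x} {x : E3} :
    ContMDiffAt (𝓡 3) ((𝓡 3).prod 𝓘(ℝ, E3)) ∞ (asSection Y) x ↔
      ContDiffAt ℝ ∞ (Y : E3 → E3) x := contMDiffAt_vectorSpace_iff_contDiffAt

/-- The components of a vector field in the frame. -/
def comp (Y : E3 → E3) (x : E3) : E3 := P.invFun x (Y x)

theorem toFun_comp (Y : E3 → E3) (x : E3) : P.toFun x (P.comp Y x) = Y x := P.right_inv x _

theorem differentiable_toFun : Differentiable ℝ P.toFun :=
  P.contDiff_toFun.differentiable (by simp)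

theorem differentiable_invFun : Differentiable ℝ P.invFun :=
  P.contDiff_invFun.differentiable (by simp)

variable {P} in
theorem _root_.DifferentiableAt.parallelization_comp {Y : E3 → E3} {x : E3}
    (hY : DifferentiableAt ℝ Y x) : DifferentiableAt ℝ (P.comp Y) x :=
  (P.differentiable_invFun x).clm_apply hY

variable {P} in
theorem _root_.ContDiffAt.parallelization_comp {Y : E3 → E3} {x : E3}
    (hY : ContDiffAt ℝ ∞ Y x) : ContDiffAt ℝ ∞ (P.comp Y) x :=
  P.contDiff_invFun.contDiffAt.clm_apply hY

theorem fderiv_eq {Y : E3 → E3} {x : E3} (hY : DifferentiableAt ℝ Y x) (v : E3) :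
    fderiv ℝ Y x v = fderiv ℝ P.toFun x v (P.comp Y x) + P.toFun x (fderiv ℝ (P.comp Y) x v) := by
  have h : Y = fun y => P.toFun y (P.comp Y y) := funext fun y => (P.toFun_comp Y y).symm
  conv_lhs => rw [h]
  rw [fderiv_clm_apply (P.differentiable_toFun x) hY.parallelization_comp]
  simp [add_comm]

/-- The bilinear map `Γ` expresses the structure functions of the frame as
`[e_a, e_b] = e_(Γ a b - Γ b a)`. -/
def HasStructure (Γ : E3 →L[ℝ] E3 →L[ℝ] E3) : Prop :=
  ∀ x a b, fderiv ℝ P.toFun x (P.toFun x a) b - fderiv ℝ P.toFun x (P.toFun x b) a =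
    P.toFun x (Γ a b - Γ b a)

variable {P} {Γ : E3 →L[ℝ] E3 →L[ℝ] E3}

/-- By the product rule for `P.toFun`, the derivatives of the frame occur only antisymmetrized,
which is what `HasStructure` controls. -/
theorem HasStructure.comp_lieBracket (h : P.HasStructure Γ) {X Y : E3 → E3} {x : E3}
    (hX : DifferentiableAt ℝ X x) (hY : DifferentiableAt ℝ Y x) :
    P.invFun x (VectorField.lieBracket ℝ X Y x) =
      fderiv ℝ (P.comp Y) x (X x) - fderiv ℝ (P.comp X) x (Y x) +
        (Γ (P.comp X x) (P.comp Y x) - Γ (P.comp Y x) (P.comp X x)) := by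
  have h1 := h x (P.comp X x) (P.comp Y x)
  rw [P.toFun_comp, P.toFun_comp] at h1
  have h2 : VectorField.lieBracket ℝ X Y x = P.toFun x (fderiv ℝ (P.comp Y) x (X x) -
      fderiv ℝ (P.comp X) x (Y x) +
        (Γ (P.comp X x) (P.comp Y x) - Γ (P.comp Y x) (P.comp X x))) := by
    rw [VectorField.lieBracket_eq]
    simp only
    rw [P.fderiv_eq hX, P.fderiv_eq hY, map_add, ← h1, map_sub]
    abel
  rw [h2, P.left_inv]

variable (P Γ) in
/-- The connection with the constant coefficients `Γ` in the frame. -/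
def connFun (Y : E3 → E3) (x : E3) : E3 →L[ℝ] E3 :=
  P.toFun x ∘L (fderiv ℝ (P.comp Y) x + (Γ.flip (P.comp Y x)) ∘L P.invFun x)

theorem connFun_apply (Y : E3 → E3) (x v : E3) : P.connFun Γ Y x v =
    P.toFun x (fderiv ℝ (P.comp Y) x v + Γ (P.invFun x v) (P.comp Y x)) := rfl

theorem connFun_add {Y Z : E3 → E3} {x : E3} (hY : DifferentiableAt ℝ Y x)
    (hZ : DifferentiableAt ℝ Z x) :
    P.connFun Γ (Y + Z) x = P.connFun Γ Y x + P.connFun Γ Z x := by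
  have h : P.comp (Y + Z) = P.comp Y + P.comp Z := funext fun y => map_add _ _ _
  ext1 v
  rw [connFun_apply, h, fderiv_add hY.parallelization_comp hZ.parallelization_comp, add_apply, add_apply,
    connFun_apply, connFun_apply, ← map_add, Pi.add_apply, map_add (Γ _)]
  congr 1
  abel

theorem connFun_smul {Y : E3 → E3} {f : E3 → ℝ} {x : E3} (hY : DifferentiableAt ℝ Y x)
    (hf : DifferentiableAt ℝ f x) :
    P.connFun Γ (f • Y) x = f x • P.connFun Γ Y x + (fderiv ℝ f x).smulRight (Y x) := by
  have h : P.comp (f • Y) = f • P.comp Y := funext fun y => map_smul (P.invFun y) (f y) (Y y)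
  ext1 v
  rw [connFun_apply, h, fderiv_smul hf hY.parallelization_comp]
  simp only [add_apply, smul_apply, ContinuousLinearMap.smulRight_apply, connFun_apply,
    Pi.smul_apply', map_add, map_smul, P.toFun_comp]
  module

variable (P Γ) in
/-- The connection with the constant coefficients `Γ` in the frame, on the tangent bundle. -/
def connection : Connection3 E3 where
  toFun Y x := P.connFun Γ Y x
  isCovariantDerivativeOnUniv :=
    { add := fun hY hZ _ => connFun_add (mdiff_iff.1 hY) (mdiff_iff.1 hZ)
      leibniz := fun {Y f x} hY hf _ => by
        have h := connFun_smul (P := P) (Γ := Γ) (mdiff_iff.1 hY)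
          (mdifferentiableAt_iff_differentiableAt.1 hf)
        have h2 : mvfderiv (𝓡 3) f x = fderiv ℝ f x := by
          unfold mvfderiv
          rw [mfderiv_eq_fderiv]
          rfl
        rw [h2]
        exact h }

theorem comp_connFun (Y Z : E3 → E3) :
    P.comp (fun y => P.connFun Γ Z y (Y y)) =
      fun y => fderiv ℝ (P.comp Z) y (Y y) + Γ (P.comp Y y) (P.comp Z y) :=
  funext fun y => P.left_inv y _

theorem mlieBracket_eq_lieBracket (X Y : Π x : E3, TangentSpace (𝓡 3) x) (x : E3) :
    VectorField.mlieBracket (𝓡 3) X Y x = VectorField.lieBracket ℝ (X : E3 → E3) Y x := by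
  rw [← VectorField.mlieBracketWithin_univ]
  exact (congrFun VectorField.mlieBracketWithin_eq_lieBracketWithin x).trans
    (congrFun VectorField.lieBracketWithin_univ x)

theorem connFun_torsion (h : P.HasStructure Γ) {X Y : E3 → E3} {x : E3}
    (hX : DifferentiableAt ℝ X x) (hY : DifferentiableAt ℝ Y x) :
    P.connFun Γ Y x (X x) - P.connFun Γ X x (Y x) = VectorField.lieBracket ℝ X Y x := by
  rw [← P.right_inv x (VectorField.lieBracket ℝ X Y x), h.comp_lieBracket hX hY, connFun_apply,
    connFun_apply, ← map_sub]
  congr 1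
  simp only [comp]
  abel

theorem connFun_metric (hs : ∀ a b c, inner ℝ (Γ a b) c = -inner ℝ b (Γ a c)) {Y Z : E3 → E3}
    {x : E3} (hY : DifferentiableAt ℝ Y x) (hZ : DifferentiableAt ℝ Z x) (v : E3) :
    fderiv ℝ (fun y => inner ℝ (P.comp Y y) (P.comp Z y)) x v =
      P.innerFun x (P.connFun Γ Y x v) (Z x) + P.innerFun x (Y x) (P.connFun Γ Z x v) := by
  rw [fderiv_inner_apply ℝ hY.parallelization_comp hZ.parallelization_comp, innerFun_apply,
    innerFun_apply, connFun_apply, connFun_apply, P.left_inv, P.left_inv, inner_add_left,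
    inner_add_right, hs]
  simp only [comp]
  ring

theorem isLeviCivita (h : P.HasStructure Γ) (hs : ∀ a b c, inner ℝ (Γ a b) c = -inner ℝ b (Γ a c)) :
    IsLeviCivita P.metric (P.connection Γ) where
  torsion_free X Y x hX hY :=
    (connFun_torsion h (mdiff_iff.1 hX) (mdiff_iff.1 hY)).trans
      (mlieBracket_eq_lieBracket X Y x).symm
  metric Y Z x v hY hZ := by
    have h2 : mvfderiv (𝓡 3) (fun y => P.metric.inner y (Y y) (Z y)) x v =
        fderiv ℝ (fun y => inner ℝ (P.comp Y y) (P.comp Z y)) x v := by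
      unfold mvfderiv
      rw [mfderiv_eq_fderiv]
      rfl
    exact h2.trans (connFun_metric hs (mdiff_iff.1 hY) (mdiff_iff.1 hZ) v)

theorem connFun_connFun {V W Z : E3 → E3} {x : E3} (hW : DifferentiableAt ℝ W x)
    (hZ : ContDiffAt ℝ ∞ Z x) :
    P.connFun Γ (fun y => P.connFun Γ Z y (W y)) x (V x) =
      P.toFun x (fderiv ℝ (fun y => fderiv ℝ (P.comp Z) y (W y)) x (V x) +
        (Γ (P.comp W x) (fderiv ℝ (P.comp Z) x (V x)) +
          Γ (fderiv ℝ (P.comp W) x (V x)) (P.comp Z x)) +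
        Γ (P.comp V x) (fderiv ℝ (P.comp Z) x (W x) + Γ (P.comp W x) (P.comp Z x))) := by
  have cZ := hZ.parallelization_comp (P := P)
  rw [connFun_apply, comp_connFun]
  have d1 : DifferentiableAt ℝ (fun y => fderiv ℝ (P.comp Z) y (W y)) x :=
    ((cZ.fderiv_right (m := 1) (by norm_num; exact ENat.LEInfty.out)).differentiableAt (by simp)).clm_apply hW
  have d2 := hW.parallelization_comp (P := P)
  have d3 := cZ.differentiableAt (by simp)
  have d4 : fderiv ℝ (fun y => Γ (P.comp W y) (P.comp Z y)) x (V x) =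
      Γ (P.comp W x) (fderiv ℝ (P.comp Z) x (V x)) +
        Γ (fderiv ℝ (P.comp W) x (V x)) (P.comp Z x) := by
    rw [(Γ.hasFDerivAt_of_bilinear d2.hasFDerivAt d3.hasFDerivAt).fderiv]
    simp
  rw [fderiv_fun_add d1 (by fun_prop), add_apply, d4]
  rfl

/-- Curvature is tensorial: all derivatives of components cancel and only the algebraic expression
in Γ survives. The second derivatives are handled by `VectorField.fderiv_apply_lieBracket`. -/
theorem connFun_curvature (h : P.HasStructure Γ) {R₀ : ℝ}
    (hR : ∀ a b c, Γ a (Γ b c) - Γ b (Γ a c) - Γ (Γ a b - Γ b a) c =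
      R₀ • ((inner ℝ b c : ℝ) • a - (inner ℝ a c : ℝ) • b)) {X Y Z : E3 → E3} {x : E3}
    (hX : DifferentiableAt ℝ X x) (hY : DifferentiableAt ℝ Y x) (hZ : ContDiffAt ℝ ∞ Z x) :
    P.connFun Γ (fun y => P.connFun Γ Z y (Y y)) x (X x) -
      P.connFun Γ (fun y => P.connFun Γ Z y (X y)) x (Y x) -
      P.connFun Γ Z x (VectorField.lieBracket ℝ X Y x) =
    R₀ • (P.innerFun x (Y x) (Z x) • X x - P.innerFun x (X x) (Z x) • Y x) := by
  have h3 := VectorField.fderiv_apply_lieBracket (V := X) (W := Y)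
    (hZ.parallelization_comp (P := P)) (by simp; exact ENat.LEInfty.out) hY hX
  have h4 : R₀ • (P.innerFun x (Y x) (Z x) • X x - P.innerFun x (X x) (Z x) • Y x) =
      P.toFun x (R₀ • ((inner ℝ (P.comp Y x) (P.comp Z x) : ℝ) • P.comp X x -
        (inner ℝ (P.comp X x) (P.comp Z x) : ℝ) • P.comp Y x)) := by
    rw [map_smul, map_sub, map_smul, map_smul, P.toFun_comp, P.toFun_comp]
    rfl
  rw [connFun_connFun hY hZ, connFun_connFun hX hZ, connFun_apply, h.comp_lieBracket hX hY, h3,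
    h4, ← hR, ← map_sub, ← map_sub]
  congr 1
  simp only [map_add, map_sub, add_apply, sub_apply]
  abel

theorem hasConstantCurvature (h : P.HasStructure Γ) {R₀ : ℝ}
    (hR : ∀ a b c, Γ a (Γ b c) - Γ b (Γ a c) - Γ (Γ a b - Γ b a) c =
      R₀ • ((inner ℝ b c : ℝ) • a - (inner ℝ a c : ℝ) • b)) :
    HasConstantCurvature P.metric (P.connection Γ) R₀ := by
  intro X Y Z x hX hY hZ
  unfold curvatureOp
  rw [mlieBracket_eq_lieBracket]
  exact connFun_curvature h hR ((cmdiff_iff.1 hX).differentiableAt (by simp))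
    ((cmdiff_iff.1 hY).differentiableAt (by simp)) (cmdiff_iff.1 hZ)

end Parallelization
end ParallelFrame

/-! ### The constant connection with prescribed modes, and its curvature identity. -/

section ModeConnection

/-- The skew-symmetric connection coefficients of an orthonormal frame `e₁ = n, e₂, e₃` with the
given constant modes, for which `a₁, a₂, a₃` are the coefficients `⟨∇_(e i) e₂, e₃⟩`. -/
def modeConn (s t bp bx D₁ D₂ a₁ a₂ a₃ : ℝ) : E3 →L[ℝ] E3 →L[ℝ] E3 :=
  IsBilinearMap.toContinuousBilinearMap (𝕜 := ℝ)
    (f := fun x y : E3 =>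
      !₂[(bx * x 0 - (t / 2 + D₂) * x 1 - (s / 2 - D₁) * x 2) * y 2
          - (-bp * x 0 + (s / 2 + D₁) * x 1 + (-t / 2 + D₂) * x 2) * y 1,
        (-bp * x 0 + (s / 2 + D₁) * x 1 + (-t / 2 + D₂) * x 2) * y 0
          - (a₁ * x 0 + a₂ * x 1 + a₃ * x 2) * y 2,
        (a₁ * x 0 + a₂ * x 1 + a₃ * x 2) * y 1
          - (bx * x 0 - (t / 2 + D₂) * x 1 - (s / 2 - D₁) * x 2) * y 0])
    { add_left := fun x x' y => by ext i; fin_cases i <;> simp <;> ring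
      smul_left := fun c x y => by ext i; fin_cases i <;> simp <;> ring
      add_right := fun x y y' => by ext i; fin_cases i <;> simp <;> ring
      smul_right := fun c x y => by ext i; fin_cases i <;> simp <;> ring }

variable {R₀ s t bp bx D₁ D₂ a₁ a₂ a₃ : ℝ}

theorem modeConn_apply (x y : E3) : modeConn s t bp bx D₁ D₂ a₁ a₂ a₃ x y =
    !₂[(bx * x 0 - (t / 2 + D₂) * x 1 - (s / 2 - D₁) * x 2) * y 2
        - (-bp * x 0 + (s / 2 + D₁) * x 1 + (-t / 2 + D₂) * x 2) * y 1,
      (-bp * x 0 + (s / 2 + D₁) * x 1 + (-t / 2 + D₂) * x 2) * y 0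
        - (a₁ * x 0 + a₂ * x 1 + a₃ * x 2) * y 2,
      (a₁ * x 0 + a₂ * x 1 + a₃ * x 2) * y 1
        - (bx * x 0 - (t / 2 + D₂) * x 1 - (s / 2 - D₁) * x 2) * y 0] := rfl

theorem inner_E3 (x y : E3) : (inner ℝ x y : ℝ) = x 0 * y 0 + x 1 * y 1 + x 2 * y 2 := by
  rw [PiLp.inner_apply, Fin.sum_univ_three]
  simp [mul_comm]

/-- In the second argument `modeConn` is the cross product with a vector depending linearly on `x`.
-/
theorem modeConn_skew (x y z : E3) : (inner ℝ (modeConn s t bp bx D₁ D₂ a₁ a₂ a₃ x y) z : ℝ) =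
    -inner ℝ y (modeConn s t bp bx D₁ D₂ a₁ a₂ a₃ x z) := by
  rw [inner_E3, inner_E3, modeConn_apply, modeConn_apply]
  simp
  ring

/-- The mixed components of the Gauss equations, for constant `a₁, a₂, a₃`. -/
structure MixedGaussEquations (s t bp bx D₁ D₂ a₁ a₂ a₃ : ℝ) : Prop where
  nn₂ : (s / 2 + D₁) * bx - bp * (t / 2 + D₂) - bp * a₁ + (s / 2 + D₁) * a₂ - a₁ * a₃
    + (t / 2 + D₂) * a₃ = 0
  nn₃ : (-t / 2 + D₂) * bx - bp * (s / 2 - D₁) - bx * a₁ + a₁ * a₂ + (-t / 2 + D₂) * a₂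
    + (s / 2 - D₁) * a₃ = 0

/-- The curvature is skew in `x, y`, and skew as an operator on `z`: nine components, matching the
six Codazzi, one Gauss and two mixed equations. The multipliers are the components of x ∧ y. -/
theorem modeConn_curvature (hC : CodazziEquations R₀ s t bp bx D₁ D₂ a₁ a₂ a₃)
    (hG : GaussEquation R₀ s t D₁ D₂ a₁ a₂ a₃)
    (hM : MixedGaussEquations s t bp bx D₁ D₂ a₁ a₂ a₃) (x y z : E3) :
    modeConn s t bp bx D₁ D₂ a₁ a₂ a₃ x (modeConn s t bp bx D₁ D₂ a₁ a₂ a₃ y z) -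
      modeConn s t bp bx D₁ D₂ a₁ a₂ a₃ y (modeConn s t bp bx D₁ D₂ a₁ a₂ a₃ x z) -
      modeConn s t bp bx D₁ D₂ a₁ a₂ a₃ (modeConn s t bp bx D₁ D₂ a₁ a₂ a₃ x y -
        modeConn s t bp bx D₁ D₂ a₁ a₂ a₃ y x) z =
    R₀ • ((inner ℝ y z : ℝ) • x - (inner ℝ x z : ℝ) • y) := by
  obtain ⟨h1, h2, h3, h4, h5, h6⟩ := hC
  obtain ⟨h7, h8⟩ := hM
  unfold GaussEquation at hG
  rw [inner_E3, inner_E3]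
  ext i
  fin_cases i
  · simp [modeConn_apply]
    linear_combination
      -(x 0 * y 1 - x 1 * y 0) * (z 1 * h1 + z 2 * h2)
      - (x 0 * y 2 - x 2 * y 0) * (z 1 * h3 + z 2 * h4)
      - (x 1 * y 2 - x 2 * y 1) * (z 1 * h5 + z 2 * h6)
  · simp [modeConn_apply]
    linear_combination
      (x 0 * y 1 - x 1 * y 0) * (z 0 * h1 - z 2 * h7)
      + (x 0 * y 2 - x 2 * y 0) * (z 0 * h3 - z 2 * h8)
      + (x 1 * y 2 - x 2 * y 1) * (z 0 * h5 - z 2 * hG)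
  · simp [modeConn_apply]
    linear_combination
      (x 0 * y 1 - x 1 * y 0) * (z 0 * h2 + z 1 * h7)
      + (x 0 * y 2 - x 2 * y 0) * (z 0 * h4 + z 1 * h8)
      + (x 1 * y 2 - x 2 * y 1) * (z 0 * h6 + z 1 * hG)

end ModeConnection

namespace Parallelization

variable (P : Parallelization)

/-- The `i`-th field of the frame. -/
def field (i : Fin 3) (x : E3) : E3 := P.toFun x (EuclideanSpace.single i 1)

variable {P}

theorem comp_field (i : Fin 3) : P.comp (P.field i) = fun _ => EuclideanSpace.single i 1 :=
  funext fun x => P.left_inv x _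

theorem contDiff_field (i : Fin 3) : ContDiff ℝ ∞ (P.field i) :=
  P.contDiff_toFun.clm_apply contDiff_const

theorem connFun_field (Γ : E3 →L[ℝ] E3 →L[ℝ] E3) (i j : Fin 3) (x : E3) :
    P.connFun Γ (P.field j) x (P.field i x) =
      P.toFun x (Γ (EuclideanSpace.single i 1) (EuclideanSpace.single j 1)) := by
  rw [connFun_apply, comp_field]
  simp [field, P.left_inv]

theorem innerFun_field (i j : Fin 3) (x : E3) :
    P.innerFun x (P.field i x) (P.field j x) = if i = j then 1 else 0 := by
  rw [innerFun_apply, field, field, P.left_inv, P.left_inv, EuclideanSpace.inner_single_left]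
  simp

theorem innerFun_connFun_field (Γ : E3 →L[ℝ] E3 →L[ℝ] E3) (i j k : Fin 3) (x : E3) :
    P.innerFun x (P.connFun Γ (P.field j) x (P.field i x)) (P.field k x) =
      Γ (EuclideanSpace.single i 1) (EuclideanSpace.single j 1) k := by
  rw [connFun_field, innerFun_apply, field, P.left_inv, P.left_inv,
    EuclideanSpace.inner_single_right]
  simp

theorem isUniformDistortion {R₀ s t bp bx D₁ D₂ a₁ a₂ a₃ : ℝ}
    (h : P.HasStructure (modeConn s t bp bx D₁ D₂ a₁ a₂ a₃))
    (hC : CodazziEquations R₀ s t bp bx D₁ D₂ a₁ a₂ a₃)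
    (hG : GaussEquation R₀ s t D₁ D₂ a₁ a₂ a₃)
    (hM : MixedGaussEquations s t bp bx D₁ D₂ a₁ a₂ a₃) :
    IsUniformDistortion P.metric (P.connection (modeConn s t bp bx D₁ D₂ a₁ a₂ a₃)) (P.field 0)
      R₀ s t bp bx D₁ D₂ where
  leviCivita := isLeviCivita h modeConn_skew
  curvature := hasConstantCurvature h (modeConn_curvature hC hG hM)
  director :=
    { smooth := contMDiff_vectorSpace_iff_contDiff.2 (contDiff_field 0)
      unit := fun x => innerFun_field 0 0 x }
  modes := fun p => by
    refine ⟨univ, mem_univ p, P.field 1, P.field 2, ?_, fun x _ => ?_⟩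
    · exact
        { isOpen := isOpen_univ
          smooth₂ := (contMDiff_vectorSpace_iff_contDiff.2 (contDiff_field 1)).contMDiffOn
          smooth₃ := (contMDiff_vectorSpace_iff_contDiff.2 (contDiff_field 2)).contMDiffOn
          unit₂ := fun x _ => innerFun_field 1 1 x
          unit₃ := fun x _ => innerFun_field 2 2 x
          orth₁₂ := fun x _ => innerFun_field 0 1 x
          orth₁₃ := fun x _ => innerFun_field 0 2 x
          orth₂₃ := fun x _ => innerFun_field 1 2 x }
    · have hg : ∀ i k, gradComp P.metric (P.connection (modeConn s t bp bx D₁ D₂ a₁ a₂ a₃))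
          (P.field 0) (P.field i) (P.field k) x = modeConn s t bp bx D₁ D₂ a₁ a₂ a₃
          (EuclideanSpace.single i 1) (EuclideanSpace.single 0 1) k :=
        fun i k => innerFun_connFun_field _ i 0 k x
      have hb : ∀ k, P.metric.inner x (bendVector (P.connection
          (modeConn s t bp bx D₁ D₂ a₁ a₂ a₃)) (P.field 0) x) (P.field k x) =
          -modeConn s t bp bx D₁ D₂ a₁ a₂ a₃
          (EuclideanSpace.single 0 1) (EuclideanSpace.single 0 1) k := by
        intro k
        rw [← hg 0 k]
        unfold bendVector
        rw [map_neg]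
        rfl
      rw [hb, hb]
      simp only [splay, twist, biaxialSplay₁, biaxialSplay₂, hg]
      simp [modeConn_apply]
      constructor <;> ring

end Parallelization

/-! ### Frames of semidirect products, and the solvable models. -/

section ExpFrame

/-- The parallelization `x ↦ exp (ℓ x • B)` of `E3`, where `B` takes its values in the kernel of
`ℓ`: the left-invariant frame of a semidirect product of `ℝ` and `ℝ²`. -/
def expParallelization (l : E3 →L[ℝ] ℝ) (B : E3 →L[ℝ] E3) : Parallelization where
  toFun x := NormedSpace.exp (l x • B)
  invFun x := NormedSpace.exp (-(l x • B))
  contDiff_toFun := by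
    have : ContDiff ℝ ∞ (NormedSpace.exp : (E3 →L[ℝ] E3) → (E3 →L[ℝ] E3)) :=
      contDiff_iff_contDiffAt.2 fun x => (NormedSpace.exp_analytic (𝕂 := ℝ) x).contDiffAt
    exact this.comp (by fun_prop)
  contDiff_invFun := by
    have : ContDiff ℝ ∞ (NormedSpace.exp : (E3 →L[ℝ] E3) → (E3 →L[ℝ] E3)) :=
      contDiff_iff_contDiffAt.2 fun x => (NormedSpace.exp_analytic (𝕂 := ℝ) x).contDiffAt
    exact this.comp (by fun_prop)
  left_inv x v := by
    let _ : NormedAlgebra ℚ (E3 →L[ℝ] E3) := NormedAlgebra.restrictScalars ℚ ℝ _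
    have h := NormedSpace.exp_add_of_commute (x := -(l x • B)) (y := l x • B)
      (by rw [commute_iff_eq]; ext; simp)
    rw [ neg_add_cancel, NormedSpace.exp_zero] at h
    exact (congrArg (fun L : E3 →L[ℝ] E3 => L v) h).symm
  right_inv x v := by
    let _ : NormedAlgebra ℚ (E3 →L[ℝ] E3) := NormedAlgebra.restrictScalars ℚ ℝ _
    have h := NormedSpace.exp_add_of_commute (x := l x • B) (y := -(l x • B))
      (by rw [commute_iff_eq]; ext; simp)
    rw [ add_neg_cancel, NormedSpace.exp_zero] at h
    exact (congrArg (fun L : E3 →L[ℝ] E3 => L v) h).symm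

theorem apply_exp_smul {l : E3 →L[ℝ] ℝ} {B : E3 →L[ℝ] E3} (hB : ∀ v, l (B v) = 0) (r : ℝ) (v : E3) :
    l (NormedSpace.exp (r • B) v) = l v := by
  have hd : ∀ u : ℝ, HasDerivAt (fun u : ℝ => l (NormedSpace.exp (u • B) v)) 0 u := by
    intro u
    have h1 := (hasDerivAt_exp_smul_const' B u).clm_apply (hasDerivAt_const u v)
    have h2 := l.hasFDerivAt.comp_hasDerivAt u h1
    convert! h2 using 1
    simp [hB]
  have h := is_const_of_deriv_eq_zero (fun u => (hd u).differentiableAt) (fun u => (hd u).deriv) r 0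
  refine h.trans ?_
  have h0 : NormedSpace.exp ((0 : ℝ) • B) = 1 :=
    (congrArg _ (zero_smul ℝ B)).trans NormedSpace.exp_zero
  exact congrArg (fun L : E3 →L[ℝ] E3 => l (L v)) h0

/-- Since ℓ ∘ B = 0, the exponential preserves ℓ, so the derivative of ℓ along e_a is the constant
ℓ(a). Hence [e_a, e_b] = e_c with c = ℓ(a)Bb - ℓ(b)Ba. -/
theorem expParallelization_hasStructure {l : E3 →L[ℝ] ℝ} {B : E3 →L[ℝ] E3}
    (hB : ∀ v, l (B v) = 0) {Γ : E3 →L[ℝ] E3 →L[ℝ] E3}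
    (hΓ : ∀ a b, Γ a b - Γ b a = l a • B b - l b • B a) :
    (expParallelization l B).HasStructure Γ := by
  intro x a b
  have hd : HasFDerivAt (expParallelization l B).toFun
      ((ContinuousLinearMap.toSpanSingleton ℝ (NormedSpace.exp (l x • B) * B)) ∘L l) x :=
    (hasDerivAt_exp_smul_const B (l x)).hasFDerivAt.comp x l.hasFDerivAt
  rw [hd.fderiv, hΓ]
  have ha : ∀ v, l ((expParallelization l B).toFun x v) = l v := apply_exp_smul hB (l x)
  simp only [ContinuousLinearMap.comp_apply, ha, ContinuousLinearMap.toSpanSingleton_apply,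
    smul_apply, map_sub, map_smul]
  rfl

end ExpFrame

section SolvableModels

variable {R₀ s t bp bx D₁ D₂ : ℝ}

/-- Hyperbolic space of curvature -|v|² as a solvable group, or flat space if v = 0, with Γ(a, b) =
⟨a, b⟩v - ⟨v, b⟩a. Reading off ∇n gives the components of `v`, and ∇e₂ gives the `a`'s (0, -bx, bp).
-/
theorem exists_isUniformDistortion_of_sq_add_sq (h : s ^ 2 + 4 * (bp ^ 2 + bx ^ 2) = -(4 * R₀)) :
    ∃ (g : Metric3 E3) (cov : Connection3 E3) (n : Π x : E3, TangentSpace (𝓡 3) x),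
      IsUniformDistortion g cov n R₀ s 0 bp bx 0 0 := by
  set v : E3 := !₂[-s / 2, -bp, -bx] with hv
  set l : E3 →L[ℝ] ℝ := innerSL ℝ v
  have hl : ∀ a, l a = -s / 2 * a 0 - bp * a 1 - bx * a 2 := fun a => by
    change inner ℝ v a = _
    rw [inner_E3, hv]
    simp
    ring
  -- This `B` is the orthogonal projection along `v`. For v = 0 the inverse is 0 and `B` is the
  -- identity, which is harmless as ℓ = 0.
  have hB : ∀ a, l ((ContinuousLinearMap.id ℝ E3 - (l v)⁻¹ • l.smulRight v) a) = 0 := by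
    intro a
    by_cases h0 : l v = 0
    · have : v = 0 := inner_self_eq_zero.1 h0
      simp [l, this]
    · simp only [sub_apply, smul_apply, ContinuousLinearMap.smulRight_apply, map_sub, map_smul,
        ContinuousLinearMap.id_apply, smul_eq_mul]
      field_simp
      ring
  have hS : (expParallelization l (ContinuousLinearMap.id ℝ E3 - (l v)⁻¹ • l.smulRight v)).HasStructure
      (modeConn s 0 bp bx 0 0 0 (-bx) bp) := by
    refine expParallelization_hasStructure hB fun a b => ?_
    have h1 : ∀ a b : E3, l a • (ContinuousLinearMap.id ℝ E3 - (l v)⁻¹ • l.smulRight v) b -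
        l b • (ContinuousLinearMap.id ℝ E3 - (l v)⁻¹ • l.smulRight v) a = l a • b - l b • a := by
      intro a b
      simp only [sub_apply, smul_apply, ContinuousLinearMap.smulRight_apply,
        ContinuousLinearMap.id_apply]
      module
    rw [h1, hl, hl, modeConn_apply, modeConn_apply]
    ext i
    fin_cases i <;> simp <;> ring
  refine ⟨_, _, _, Parallelization.isUniformDistortion hS ?_ ?_ ?_⟩
  · constructor <;> linarith
  · unfold GaussEquation; linarith
  · constructor <;> ring

/-- The biaxial modes in the principal frame, in terms of the rescaled bend vector
`(x, y) = 𝐛 / (2 d)` and the sign `σ` of the twist. -/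
theorem exists_isUniformDistortion_principal {d x y σ : ℝ} (hσ : σ = 1 ∨ σ = -1)
    (hs : s = 2 * d * (y ^ 2 - x ^ 2))
    (hR : R₀ = -2 * d ^ 2 * (x ^ 2 + y ^ 2) - d ^ 2 * (y ^ 2 - x ^ 2) ^ 2
      + 4 * σ * d ^ 2 * (x * y)) :
    ∃ (g : Metric3 E3) (cov : Connection3 E3) (n : Π x : E3, TangentSpace (𝓡 3) x),
      IsUniformDistortion g cov n R₀ s (2 * σ * d) (2 * d * x) (2 * d * y) d 0 := by
  -- The values forced by `a₁_eq`, `a₂_eq`, `a₃_eq`.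
  set a₁ : ℝ := -d * (σ * (x ^ 2 + y ^ 2) + 2 * x * y) with ha₁
  set a₂ : ℝ := 2 * d * σ * x with ha₂
  set a₃ : ℝ := -2 * d * σ * y with ha₃
  set l : E3 →L[ℝ] ℝ := innerSL ℝ !₂[x + σ * y, -1, σ]
  have hl : ∀ a, l a = (x + σ * y) * a 0 - a 1 + σ * a 2 := fun a => by
    change inner ℝ _ a = _
    rw [inner_E3]
    simp
    ring
  -- With the normalization ℓ = -1 and B = 0 on the field of index 1, `B a` must be the bracket of
  -- e_a with that field. The kernel of ℓ is the abelian ideal.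
  set B : E3 →L[ℝ] E3 := LinearMap.toContinuousLinearMap
    { toFun := fun a => !₂[2 * d * x * a 0 + 2 * σ * d * a 2, -(s / 2 + d) * a 0 + a₂ * a 2,
        (a₁ - σ * d) * a 0 + a₃ * a 2]
      map_add' := fun a b => by ext i; fin_cases i <;> simp <;> ring
      map_smul' := fun c a => by ext i; fin_cases i <;> simp <;> ring }
  have hBa : ∀ a, B a = !₂[2 * d * x * a 0 + 2 * σ * d * a 2, -(s / 2 + d) * a 0 + a₂ * a 2,
        (a₁ - σ * d) * a 0 + a₃ * a 2] := fun a => rfl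
  have hB : ∀ a, l (B a) = 0 := by
    intro a
    rw [hl, hBa, hs, ha₁, ha₂, ha₃]
    simp
    rcases hσ with rfl | rfl <;> ring
  have hS : (expParallelization l B).HasStructure
      (modeConn s (2 * σ * d) (2 * d * x) (2 * d * y) d 0 a₁ a₂ a₃) := by
    refine expParallelization_hasStructure hB fun a b => ?_
    rw [hl, hl, modeConn_apply, modeConn_apply, hBa, hBa, hs, ha₁, ha₂, ha₃]
    ext i
    fin_cases i <;> simp <;> rcases hσ with rfl | rfl <;> ring
  refine ⟨_, _, _, Parallelization.isUniformDistortion hS ?_ ?_ ?_⟩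
  · constructor <;> (try rw [hs]) <;> (try rw [hR]) <;> (try rw [ha₁]) <;> (try rw [ha₂]) <;>
      (try rw [ha₃]) <;> rcases hσ with rfl | rfl <;> ring
  · unfold GaussEquation
    rw [hs, hR, ha₁, ha₂, ha₃]
    rcases hσ with rfl | rfl <;> ring
  · constructor <;> rw [hs, ha₁, ha₂, ha₃] <;> rcases hσ with rfl | rfl <;> ring

end SolvableModels

/-! ### Reduction of general biaxial modes to the principal frame. -/

section Rotation

variable {M : Type*} [TopologicalSpace M] [ChartedSpace E3 M] [IsManifold (𝓡 3) ∞ M]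
  {g : Metric3 M} {cov : Connection3 M} {n n₂ n₃ : Π x : M, TangentSpace (𝓡 3) x}
  {R₀ s t bp bx D₁ D₂ : ℝ}

theorem IsAdaptedFrameOn.rotate {U : Set M} (h : IsAdaptedFrameOn g n n₂ n₃ U) {c e : ℝ}
    (hce : c ^ 2 + e ^ 2 = 1) :
    IsAdaptedFrameOn g n (c • n₂ + e • n₃) (-e • n₂ + c • n₃) U where
  isOpen := h.isOpen
  smooth₂ := h.smooth₂.const_smul_section.add_section h.smooth₃.const_smul_section
  smooth₃ := h.smooth₂.const_smul_section.add_section h.smooth₃.const_smul_section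
  unit₂ x hx := by
    simp [h.unit₂ x hx, h.unit₃ x hx, h.orth₂₃ x hx, g.symm x (n₃ x) (n₂ x)]
    linarith
  unit₃ x hx := by
    simp [h.unit₂ x hx, h.unit₃ x hx, h.orth₂₃ x hx, g.symm x (n₃ x) (n₂ x)]
    linarith
  orth₁₂ x hx := by simp [h.orth₁₂ x hx, h.orth₁₃ x hx]
  orth₁₃ x hx := by simp [h.orth₁₂ x hx, h.orth₁₃ x hx]
  orth₂₃ x hx := by
    simp [h.unit₂ x hx, h.unit₃ x hx, h.orth₂₃ x hx, g.symm x (n₃ x) (n₂ x)]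
    ring

/-- Rotating the frames of the normal planes by a constant angle rotates the modes. -/
theorem IsUniformDistortion.rotate (h : IsUniformDistortion g cov n R₀ s t bp bx D₁ D₂) {c e : ℝ}
    (hce : c ^ 2 + e ^ 2 = 1) :
    IsUniformDistortion g cov n R₀ s t (c * bp + e * bx) (-e * bp + c * bx)
      ((c ^ 2 - e ^ 2) * D₁ + 2 * c * e * D₂) ((c ^ 2 - e ^ 2) * D₂ - 2 * c * e * D₁) where
  leviCivita := h.leviCivita
  curvature := h.curvature
  director := h.director
  modes p := by
    obtain ⟨U, hp, n₂, n₃, hf, hm⟩ := h.modes p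
    refine ⟨U, hp, _, _, hf.rotate hce, fun x hx => ?_⟩
    obtain ⟨h1, h2, h3, h4, h5, h6⟩ := hm x hx
    simp only [splay, twist, biaxialSplay₁, biaxialSplay₂, gradComp] at h1 h2 h5 h6 ⊢
    simp only [Pi.add_apply, Pi.smul_apply, map_add, map_smul, add_apply, smul_apply, smul_eq_mul,
      h3, h4]
    refine ⟨?_, ?_, trivial, trivial, ?_, ?_⟩
    · rw [← h1]; linear_combination (g.inner x (cov n x (n₂ x)) (n₂ x)
        + g.inner x (cov n x (n₃ x)) (n₃ x)) * hce
    · rw [← h2]; linear_combination (g.inner x (cov n x (n₂ x)) (n₃ x)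
        - g.inner x (cov n x (n₃ x)) (n₂ x)) * hce
    · rw [← h5, ← h6]; ring
    · rw [← h5, ← h6]; ring

end Rotation

section Biaxial

variable {R₀ s t bp bx D₁ D₂ : ℝ}

theorem BiaxialModes.exists_isUniformDistortion (h : BiaxialModes R₀ s t bp bx D₁ D₂)
    (hD : splayNorm D₁ D₂ ≠ 0) :
    ∃ (g : Metric3 E3) (cov : Connection3 E3) (n : Π x : E3, TangentSpace (𝓡 3) x),
      IsUniformDistortion g cov n R₀ s t bp bx D₁ D₂ := by
  obtain ⟨e₁, e₂, he, h1, h2⟩ := exists_principal D₁ D₂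
  have ht : ∃ σ : ℝ, (σ = 1 ∨ σ = -1) ∧ t = 2 * σ * splayNorm D₁ D₂ := by
    rcases eq_or_eq_neg_splayNorm h.twist with ht | ht
    · exact ⟨1, Or.inl rfl, by rw [ht]; ring⟩
    · exact ⟨-1, Or.inr rfl, by rw [ht]; ring⟩
  obtain ⟨σ, hσ, ht⟩ := ht
  have hs := h.splay
  have hR := h.curvature
  rw [← splayNorm_sq] at hs hR
  generalize splayNorm D₁ D₂ = d at *
  obtain ⟨x, hx⟩ : ∃ x, e₁ * bp + e₂ * bx = 2 * d * x :=
    ⟨(e₁ * bp + e₂ * bx) / (2 * d), by field_simp⟩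
  obtain ⟨y, hy⟩ : ∃ y, e₁ * bx - e₂ * bp = 2 * d * y :=
    ⟨(e₁ * bx - e₂ * bp) / (2 * d), by field_simp⟩
  have hbp : bp = 2 * d * (e₁ * x - e₂ * y) := by
    linear_combination -bp * he + e₁ * hx - e₂ * hy
  have hbx : bx = 2 * d * (e₂ * x + e₁ * y) := by
    linear_combination -bx * he + e₂ * hx + e₁ * hy
  have he2 : (e₁ ^ 2 + e₂ ^ 2) ^ 2 = 1 := by rw [he]; norm_num
  have hF : formDb bp bx D₁ D₂ = d * (2 * d) ^ 2 * (x ^ 2 - y ^ 2) := by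
    rw [h1, h2, hbp, hbx]
    unfold formDb
    linear_combination d * (2 * d) ^ 2 * (x ^ 2 - y ^ 2) * he2
  have hJ : formJDb bp bx D₁ D₂ = d * (2 * d) ^ 2 * (2 * x * y) := by
    rw [h1, h2, hbp, hbx]
    unfold formJDb
    linear_combination d * (2 * d) ^ 2 * (2 * x * y) * he2
  have hb : bp ^ 2 + bx ^ 2 = (2 * d) ^ 2 * (x ^ 2 + y ^ 2) := by
    rw [hbp, hbx]
    linear_combination (2 * d) ^ 2 * (x ^ 2 + y ^ 2) * he
  have hs' : s = 2 * d * (y ^ 2 - x ^ 2) := by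
    rw [hF] at hs
    refine mul_left_cancel₀ (pow_ne_zero 2 hD) ?_
    linarith
  have hR' : R₀ = -2 * d ^ 2 * (x ^ 2 + y ^ 2) - d ^ 2 * (y ^ 2 - x ^ 2) ^ 2
      + 4 * σ * d ^ 2 * (x * y) := by
    rw [hJ, hb, ht, hs'] at hR
    refine mul_left_cancel₀ (pow_ne_zero 2 hD) ?_
    linarith
  obtain ⟨g, cov, n, hg⟩ := exists_isUniformDistortion_principal hσ hs' hR'
  refine ⟨g, cov, n, ?_⟩
  -- Rotating back from the principal frame: the bend turns by the angle of (e₁, e₂), and (Δ₁, Δ₂)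
  -- by twice that angle.
  have hr := hg.rotate (c := e₁) (e := -e₂) (by rw [neg_sq, he])
  rw [ht]
  convert! hr using 1
  · rw [hbp]; ring
  · rw [hbx]; ring
  · rw [h1]; ring
  · rw [h2]; ring

end Biaxial

/-! ### The Hopf director field on the 3-sphere. -/

section Sphere

/-- The cross product of `E3`. -/
def crossE3 : E3 →L[ℝ] E3 →L[ℝ] E3 := modeConn 0 (-2) 0 0 0 0 1 0 0

theorem crossE3_apply (x y : E3) : crossE3 x y =
    !₂[x 1 * y 2 - x 2 * y 1, x 2 * y 0 - x 0 * y 2, x 0 * y 1 - x 1 * y 0] := by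
  rw [crossE3, modeConn_apply]
  ext i
  fin_cases i <;> simp

/-- The left-invariant frame of the 3-sphere in stereographic coordinates, up to normalization. -/
def hopfFun (x : E3) : E3 →L[ℝ] E3 :=
  (1 - inner ℝ x x : ℝ) • ContinuousLinearMap.id ℝ E3 + (2 : ℝ) • (innerSL ℝ x).smulRight x
    + (2 : ℝ) • crossE3 x

theorem hopfFun_apply (x a : E3) : hopfFun x a =
    (1 - inner ℝ x x : ℝ) • a + (2 : ℝ) • (inner ℝ x a : ℝ) • x + (2 : ℝ) • crossE3 x a := rfl

theorem contDiff_hopfFun : ContDiff ℝ ∞ hopfFun := by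
  have h1 : ContDiff ℝ ∞ fun x : E3 => (innerSL ℝ x).smulRight x :=
    (innerSL ℝ).contDiff.smulRight contDiff_id
  have h2 : ContDiff ℝ ∞ fun x : E3 => (inner ℝ x x : ℝ) := contDiff_id.inner ℝ contDiff_id
  exact (((contDiff_const.sub h2).smul contDiff_const).add (h1.const_smul (2 : ℝ))).add
    (crossE3.contDiff.const_smul (2 : ℝ))

/-- `hopfFun (-x)` is the transpose of `hopfFun x`, and `hopfFun x` is 1 + |x|² times an orthogonal
map; this gives the inverse and makes the metric conformal to the Euclidean one. -/
theorem hopfFun_neg_hopfFun (x a : E3) :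
    hopfFun (-x) (hopfFun x a) = ((1 + inner ℝ x x) ^ 2 : ℝ) • a := by
  simp only [hopfFun_apply, crossE3_apply, inner_E3]
  ext i
  fin_cases i <;> simp <;> ring

theorem fderiv_hopfFun (x v a : E3) : fderiv ℝ hopfFun x v a =
    (-2 * inner ℝ x v : ℝ) • a + (2 : ℝ) • (inner ℝ v a : ℝ) • x + (2 : ℝ) • (inner ℝ x a : ℝ) • v
      + (2 : ℝ) • crossE3 v a := by
  have hd : HasFDerivAt hopfFun (fderiv ℝ hopfFun x) x :=
    (contDiff_hopfFun.differentiable (by simp) x).hasFDerivAt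
  have h1 := hd.clm_apply (hasFDerivAt_const a x)
  have h2 := (((((hasFDerivAt_id x).inner ℝ (hasFDerivAt_id x)).const_sub 1).smul
    (hasFDerivAt_const a x)).add ((((hasFDerivAt_id x).inner ℝ (hasFDerivAt_const a x)).smul
    (hasFDerivAt_id x)).const_smul (2 : ℝ))).add
    ((crossE3.flip a).hasFDerivAt.const_smul (2 : ℝ) (x := x))
  -- Differentiating x ↦ `hopfFun x a` in two ways identifies the operator-valued derivative.
  have h3 := congrArg (fun L : E3 →L[ℝ] E3 => L v) (h1.unique h2)
  simp at h3
  rw [h3, real_inner_comm v x]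
  module

/-- The left-invariant frame of the 3-sphere of curvature `r ^ 2` in stereographic coordinates. -/
def hopfParallelization {r : ℝ} (hr : r ≠ 0) : Parallelization where
  toFun x := (r / 2) • hopfFun x
  invFun x := (2 / r * ((1 + inner ℝ x x) ^ 2 : ℝ)⁻¹) • hopfFun (-x)
  contDiff_toFun := contDiff_hopfFun.const_smul _
  contDiff_invFun := by
    have h1 : ContDiff ℝ ∞ fun x : E3 => ((1 + inner ℝ x x) ^ 2 : ℝ)⁻¹ := by
      refine ContDiff.inv ((contDiff_const.add (contDiff_id.inner ℝ contDiff_id)).pow 2) fun x => ?_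
      have : (0 : ℝ) ≤ inner ℝ x x := real_inner_self_nonneg
      positivity
    have h2 : ContDiff ℝ ∞ fun x : E3 => hopfFun (-x) := contDiff_hopfFun.comp contDiff_neg
    exact (contDiff_const.mul h1).smul h2
  left_inv x v := by
    have : (0 : ℝ) ≤ inner ℝ x x := real_inner_self_nonneg
    have h0 : (1 + inner ℝ x x : ℝ) ^ 2 ≠ 0 := by positivity
    simp only [smul_apply, map_smul, hopfFun_neg_hopfFun, smul_smul]
    convert! one_smul ℝ v using 2
    field_simp
  right_inv x v := by
    have : (0 : ℝ) ≤ inner ℝ x x := real_inner_self_nonneg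
    have h0 : (1 + inner ℝ x x : ℝ) ^ 2 ≠ 0 := by positivity
    have h := hopfFun_neg_hopfFun (-x) v
    rw [neg_neg, inner_neg_neg] at h
    simp only [smul_apply, map_smul, h, smul_smul]
    convert! one_smul ℝ v using 2
    field_simp

theorem hopfParallelization_hasStructure {r : ℝ} (hr : r ≠ 0) :
    (hopfParallelization hr).HasStructure (modeConn 0 (-2 * r) 0 0 0 0 r 0 0) := by
  intro x a b
  have hd0 : HasFDerivAt hopfFun (fderiv ℝ hopfFun x) x :=
    (contDiff_hopfFun.differentiable (by simp) x).hasFDerivAt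
  have hd1 : HasFDerivAt (hopfParallelization hr).toFun ((r / 2) • fderiv ℝ hopfFun x) x :=
    hd0.const_smul (r / 2)
  have hd := hd1.fderiv
  have ht : ∀ c, (hopfParallelization hr).toFun x c = (r / 2) • hopfFun x c := fun c => rfl
  rw [hd, ht, ht, ht]
  simp only [smul_apply, map_smul, fderiv_hopfFun]
  simp only [hopfFun_apply, crossE3_apply, modeConn_apply, inner_E3]
  ext i
  fin_cases i <;> simp <;> ring

theorem exists_isUniformDistortion_of_pos {R₀ t : ℝ} (hR : 0 < R₀) (ht : t ^ 2 = 4 * R₀) :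
    ∃ (g : Metric3 E3) (cov : Connection3 E3) (n : Π x : E3, TangentSpace (𝓡 3) x),
      IsUniformDistortion g cov n R₀ 0 t 0 0 0 0 := by
  -- The sign of `r` carries the handedness, so both signs of the twist are covered; the curvature
  -- is r².
  obtain ⟨r, rfl⟩ : ∃ r, t = -2 * r := ⟨-t / 2, by ring⟩
  have hr : r ≠ 0 := by
    rintro rfl
    linarith
  refine ⟨_, _, _, Parallelization.isUniformDistortion (hopfParallelization_hasStructure hr) ?_ ?_ ?_⟩
  · constructor <;> linarith
  · unfold GaussEquation; linarith
  · constructor <;> ring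

end Sphere
end

theorem mainTheorem2 :
    (∀ (M : Type*) [TopologicalSpace M] [ChartedSpace E3 M] [IsManifold (𝓡 3) ∞ M] [Nonempty M]
        (g : Metric3 M) (cov : Connection3 M) (n : Π x : M, TangentSpace (𝓡 3) x)
        (R₀ s t bp bx D₁ D₂ : ℝ),
        IsUniformDistortion g cov n R₀ s t bp bx D₁ D₂ →
        (0 < R₀ → s = 0 ∧ bendNorm bp bx = 0 ∧ splayNorm D₁ D₂ = 0 ∧
          (t = 2 * Real.sqrt R₀ ∨ t = -(2 * Real.sqrt R₀))) ∧
        (R₀ = 0 →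
          (splayNorm D₁ D₂ = 0 → bendNorm bp bx = 0 ∧ s = 0 ∧ t = 0) ∧
          (splayNorm D₁ D₂ ≠ 0 → s = 0 ∧
            (t = 2 * splayNorm D₁ D₂ ∨ t = -(2 * splayNorm D₁ D₂)) ∧
            BendBisects t bp bx D₁ D₂)) ∧
        (R₀ < 0 →
          (splayNorm D₁ D₂ = 0 → t = 0 ∧ s ^ 2 + 4 * bendNorm bp bx ^ 2 = -(4 * R₀)) ∧
          (splayNorm D₁ D₂ ≠ 0 →
            (t = 2 * splayNorm D₁ D₂ ∨ t = -(2 * splayNorm D₁ D₂)) ∧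
            s = -(formDb bp bx D₁ D₂ / (2 * splayNorm D₁ D₂ ^ 2)) ∧
            1 + bendNorm bp bx ^ 2 / (4 * splayNorm D₁ D₂ ^ 2) ≥
              Real.sqrt (-R₀ / splayNorm D₁ D₂ ^ 2) ∧
            2 * R₀ = -bendNorm bp bx ^ 2 - s ^ 2 / 2 +
              t * formJDb bp bx D₁ D₂ / (2 * splayNorm D₁ D₂ ^ 2)))) ∧
    (∀ R₀ s t bp bx D₁ D₂ : ℝ,
        ((0 < R₀ ∧ s = 0 ∧ bendNorm bp bx = 0 ∧ splayNorm D₁ D₂ = 0 ∧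
            (t = 2 * Real.sqrt R₀ ∨ t = -(2 * Real.sqrt R₀))) ∨
          (R₀ = 0 ∧ splayNorm D₁ D₂ = 0 ∧ bendNorm bp bx = 0 ∧ s = 0 ∧ t = 0) ∨
          (R₀ = 0 ∧ splayNorm D₁ D₂ ≠ 0 ∧ s = 0 ∧
            (t = 2 * splayNorm D₁ D₂ ∨ t = -(2 * splayNorm D₁ D₂)) ∧
            BendBisects t bp bx D₁ D₂) ∨
          (R₀ < 0 ∧ splayNorm D₁ D₂ = 0 ∧ t = 0 ∧
            s ^ 2 + 4 * bendNorm bp bx ^ 2 = -(4 * R₀)) ∨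
          (R₀ < 0 ∧ splayNorm D₁ D₂ ≠ 0 ∧
            (t = 2 * splayNorm D₁ D₂ ∨ t = -(2 * splayNorm D₁ D₂)) ∧
            s = -(formDb bp bx D₁ D₂ / (2 * splayNorm D₁ D₂ ^ 2)) ∧
            2 * R₀ = -bendNorm bp bx ^ 2 - s ^ 2 / 2 +
              t * formJDb bp bx D₁ D₂ / (2 * splayNorm D₁ D₂ ^ 2))) →
        ∃ (g : Metric3 E3) (cov : Connection3 E3) (n : Π x : E3, TangentSpace (𝓡 3) x),
          IsUniformDistortion g cov n R₀ s t bp bx D₁ D₂) := by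
  refine ⟨fun M _ _ _ _ g cov n R₀ s t bp bx D₁ D₂ h => ⟨h.of_pos, h.of_zero, h.of_neg⟩, ?_⟩
  rintro R₀ s t bp bx D₁ D₂ (⟨hR, rfl, hb, hD, ht⟩ | ⟨rfl, hD, hb, rfl, rfl⟩ |
    ⟨rfl, hD, rfl, ht, hB⟩ | ⟨hR, hD, rfl, hs⟩ | ⟨hR, hD, ht, hs, hR'⟩)
  · obtain ⟨rfl, rfl⟩ := bendNorm_eq_zero.1 hb
    obtain ⟨rfl, rfl⟩ := splayNorm_eq_zero.1 hD
    refine exists_isUniformDistortion_of_pos hR ?_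
    have := Real.sq_sqrt hR.le
    rcases ht with rfl | rfl <;> linarith
  · obtain ⟨rfl, rfl⟩ := bendNorm_eq_zero.1 hb
    obtain ⟨rfl, rfl⟩ := splayNorm_eq_zero.1 hD
    exact exists_isUniformDistortion_of_sq_add_sq (by ring)
  · exact (hB.biaxialModes hD ht).exists_isUniformDistortion hD
  · obtain ⟨rfl, rfl⟩ := splayNorm_eq_zero.1 hD
    rw [bendNorm_sq] at hs
    exact exists_isUniformDistortion_of_sq_add_sq (by linarith)
  · exact (BiaxialModes.of_eq hD ht hs hR').exists_isUniformDistortion hD
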